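/- A metric space is called proper if all its closed balls are compact. For a proper metric space $X$ let $C_h(X)$ be the set of all continuous slowly oscillating functions $\phi\colon X\to[0,1]$. Here $\phi$ is slowly oscillating if for all $r,\varepsilon>0$ there is a bounded set $K\subset X$ such that $\operatorname{diam}\phi(B_r(x))<\varepsilon$ for every $x\in X\setminus K$, where $B_r(x)$ is the open ball. Let $cX$ be the Higson compactification, that is, the closure of the image of $X$ under $x\mapsto(\phi(x))_{\phi\in C_h(X)}\in[0,1]^{C_h(X)}$. Let $\nu X=cX\setminus X$ be the Higson corona, with the subspace topology, and for $A\subset X$ put $A'=\operatorname{cl}_{cX}A\cap\nu X$. For $x\in\nu X$ and $A\subset X$ with $x\notin A'$, an asymptotic separator for $x$ and $A$ is a closed subset $C\subset X$ for which there are disjoint open sets $U_1,U_2\subset\nu X$ with $\nu X\setminus C'=U_1\cup U_2$, $x\in U_1$ and $A'\subset U_2$. A closed subset $C\subset X$ is regarded as a proper metric space with the restricted metric. The asymptotic small inductive dimension $\operatorname{asind}X\in\{-1,0,1,\dots\}\cup\{\infty\}$ is defined as follows: $\operatorname{asind}X=-1$ if and only if $X$ is bounded; for an integer $n\ge 0$,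 $\operatorname{asind}X\le n$ if for every $x\in\nu X$ and every $A\subset X$ with $x\notin A'$ there is an asymptotic separator $C$ for $x$ and $A$ with $\operatorname{asind}C\le n-1$; $\operatorname{asind}X$ is the least such bound, and $\operatorname{asind}X=\infty$ if there is none. Its transfinite extension $\operatorname{trasind}X$, whose value is $-1$, an ordinal or $\infty$, is defined as follows: $\operatorname{trasind}X=-1$ if and only if $X$ is bounded; for an ordinal $\alpha$, $\operatorname{trasind}X\le\alpha$ if for every $x\in\nu X$ and every $A\subset X$ with $x\notin A'$ there is an asymptotic separator $C$ for $x$ and $A$ with $\operatorname{trasind}C\le\beta$ for some $\beta<\alpha$, where $\beta$ is an ordinal or $-1$; $\operatorname{trasind}X$ is the least such bound, and $\operatorname{trasind}X=\infty$ if there is none. **Theorem.** If $X$ is a proper metric space with $\operatorname{trasind}X<\infty$, then $\operatorname{asind}X<\infty$. -/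

import Mathlib

open Set Bornology

universe u

noncomputable section

/-- `C` is a partition between `A₁` and `A₂` in the topological space `Y`. -/
def IsPartition {Y : Type u} [TopologicalSpace Y] (A₁ A₂ C : Set Y) : Prop :=
  ∃ U₁ U₂ : Set Y, IsOpen U₁ ∧ IsOpen U₂ ∧ Disjoint U₁ U₂ ∧ Cᶜ = U₁ ∪ U₂ ∧ A₁ ⊆ U₁ ∧ A₂ ⊆ U₂

/-- A map `φ : X → [0,1]` is slowly oscillating if for all `r, ε > 0` one has
`diam φ(B_r(x)) < ε` for all `x` outside some ball around the base point. Filtering along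
`cobounded X` says this without choosing a base point. -/
def IsSlowlyOscillating {X : Type u} [MetricSpace X] (φ : X → unitInterval) : Prop :=
  ∀ r > (0 : ℝ), ∀ ε > (0 : ℝ), ∀ᶠ x in cobounded X, Metric.diam (φ '' Metric.ball x r) < ε

/-- The set `C_h(X)` of continuous slowly oscillating functions `X → [0,1]`. -/
def HigsonFunction (X : Type u) [MetricSpace X] : Type u :=
  {φ : C(X, unitInterval) // IsSlowlyOscillating φ}

/-- The evaluation map `Φ : X → [0,1]^{C_h(X)}`. -/
def higsonMap (X : Type u) [MetricSpace X] (x : X) : HigsonFunction X → unitInterval :=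
  fun φ => φ.1 x

/-- The Higson compactification `cX`, as a subset of the cube `[0,1]^{C_h(X)}`. -/
def higsonCompactification (X : Type u) [MetricSpace X] : Set (HigsonFunction X → unitInterval) :=
  closure (range (higsonMap X))

/-- The Higson corona `νX = cX \ X`; it is used as a topological space with the subspace
topology. -/
def higsonCorona (X : Type u) [MetricSpace X] : Set (HigsonFunction X → unitInterval) :=
  higsonCompactification X \ range (higsonMap X)

/-- The trace `A' = cl A ∩ νX` of `A ⊆ X` in the Higson corona, as a subset of `νX`. -/
def higsonTrace {X : Type u} [MetricSpace X] (A : Set X) : Set (higsonCorona X) :=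
  {x | (x : HigsonFunction X → unitInterval) ∈ closure (higsonMap X '' A)}

/-- `C ⊆ X` is an asymptotic separator for the point `x ∈ νX` and the set `A ⊆ X`. -/
def IsAsymptoticSeparator {X : Type u} [MetricSpace X] (x : higsonCorona X) (A C : Set X) : Prop :=
  IsPartition {x} (higsonTrace A) (higsonTrace C)

/-- `X` is bounded. -/
def IsBoundedSpace (X : Type u) [MetricSpace X] : Prop :=
  IsBounded (univ : Set X)

/-- `AsindLE n X` is the relation `asind X ≤ n` for natural `n`. The relation
`asind X ≤ -1` means that `X` is bounded. The separators are closed, that is, they are again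
proper metric spaces when `X` is one. -/
def AsindLE : ℕ → ∀ (X : Type u) [MetricSpace X], Prop
  | 0, X, _ => ∀ (x : higsonCorona X) (A : Set X), x ∉ higsonTrace A →
      ∃ C : Set X, IsClosed C ∧ IsAsymptoticSeparator x A C ∧ IsBoundedSpace C
  | n + 1, X, _ => ∀ (x : higsonCorona X) (A : Set X), x ∉ higsonTrace A →
      ∃ C : Set X, IsClosed C ∧ IsAsymptoticSeparator x A C ∧ AsindLE n C

/-- The asymptotic small inductive dimension `asind X ∈ {-1, 0, 1, …, ∞}`, where `⊥`
stands for `-1` and `⊤` for `∞`. -/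
def asind (X : Type u) [MetricSpace X] : WithBot ℕ∞ :=
  sInf {d | (d = ⊥ ∧ IsBoundedSpace X) ∨ ∃ n : ℕ, d = ((n : ℕ∞) : WithBot ℕ∞) ∧ AsindLE n X}

/-- `TrasindLE α X` is the relation `trasind X ≤ α` for an ordinal `α`: the separators satisfy
`trasind C ≤ β` for some `β < α`, where `β` is an ordinal or `-1`. The relation
`trasind X ≤ -1` means that `X` is bounded. -/
def TrasindLE (α : Ordinal.{u}) (X : Type u) [MetricSpace X] : Prop :=
  ∀ (x : higsonCorona X) (A : Set X), x ∉ higsonTrace A →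
    ∃ C : Set X, IsClosed C ∧ IsAsymptoticSeparator x A C ∧
      (IsBoundedSpace C ∨ ∃ β : Ordinal.{u}, ∃ _ : β < α, TrasindLE β C)
termination_by α

/-- The transfinite extension `trasind X` of `asind X`: its value is `-1` (that is, `⊥`), an
ordinal, or `∞` (that is, `⊤`). -/
def trasind (X : Type u) [MetricSpace X] : WithTop (WithBot Ordinal.{u}) :=
  sInf {d | (d = ⊥ ∧ IsBoundedSpace X) ∨
    ∃ α : Ordinal.{u}, d = ((α : WithBot Ordinal.{u}) : WithTop (WithBot Ordinal.{u})) ∧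
      TrasindLE α X}

end

-- Transfinite induction on `α` reduces the theorem to `exists_coarseDimLT_univ`: if
-- finite-dimensional separators exist at every point of the corona, their dimensions have a common
-- bound. A set enters only through `Diverge`, which says that traces are disjoint, and a corona
-- point only through the ultrafilters converging to it.
--
-- Suppose the dimension is infinite. Then for each `n` some end is bad at level `n` (not
-- `SeparableAt n`), and these ends cluster at an end `y`. If bad ends of every level, distinct from
-- `y` in the corona, occur in every neighbourhood of `y`, choose a sequence of them with mutually
-- diverging neighbourhoods. A finite-dimensional separator around a cluster end of the sequence,
-- cut down to a neighbourhood of large index, separates the bad end there in too low a dimension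
-- (`not_exists_diverging_sequence`). Otherwise, in some neighbourhood, only `y` itself is bad at
-- some level `N`. A separator around `y` inside it has only good ends, hence dimension at most `N`,
-- and so `y` is not bad at level `N + 1`.
--
-- Both cases need monotonicity of dimension under inclusion. Intersecting a separator with the
-- subset does not suffice, because the trace of an intersection can be smaller than the
-- intersection of the traces. `IsSubordination` enlarges the class of inclusions until the
-- induction closes: the separator is replaced by a sparse set of points of the subset, and these
-- may jump far to reach it as long as they are isolated (`IsSubordination.exists_sparse`).

section Coarse

variable {X Y : Type*} [MetricSpace X] [MetricSpace Y]

-- Divergence and coarse dimension.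

/-- Two subsets of a metric space diverge if, for every `r`, only a bounded part of the first is
within distance `r` of the second. -/
def Diverge (A B : Set X) : Prop :=
  ∀ r : ℝ, IsBounded {a ∈ A | ∃ b ∈ B, dist a b ≤ r}

/-- The ultrafilter `u` contains a set diverging from `A`. -/
def AwayFrom (u : Ultrafilter X) (A : Set X) : Prop :=
  ∃ U ∈ u, Diverge U A

/-- Within `S`, the set `C` separates the end `u` from the set `A`: the subsets of `S` diverging
from `C` split into two mutually diverging families, one for `u` and one for `A`. -/
def CoarseSeparator (S : Set X) (u : Ultrafilter X) (A C : Set X) : Prop :=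
  ∃ 𝒱₁ 𝒱₂ : Set (Set X), (∀ V₁ ∈ 𝒱₁, ∀ V₂ ∈ 𝒱₂, Diverge V₁ V₂) ∧
    (∀ D ⊆ S, Diverge D C → ∃ V₁ ∈ 𝒱₁, ∃ V₂ ∈ 𝒱₂, D = V₁ ∪ V₂) ∧
    (∃ B ∈ u, B ∈ 𝒱₁ ∧ Diverge B C) ∧ (∃ V₂ ∈ 𝒱₂, A ⊆ V₂) ∧ Diverge A C

/-- `CoarseDimLT n S` says that `S` has coarse small inductive dimension less than `n`. -/
def CoarseDimLT : ℕ → Set X → Prop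
  | 0, S => IsBounded S
  | n + 1, S => ∀ u : Ultrafilter X, (u : Filter X) ≤ cobounded X → S ∈ u → ∀ A ⊆ S,
      AwayFrom u A → ∃ C ⊆ S, CoarseSeparator S u A C ∧ CoarseDimLT n C

/-- At the end `u` of `S` there are separators of coarse dimension less than `n`. -/
def SeparableAt (n : ℕ) (S : Set X) (u : Ultrafilter X) : Prop :=
  ∀ A ⊆ S, AwayFrom u A → ∃ C ⊆ S, CoarseSeparator S u A C ∧ CoarseDimLT n C

theorem notMem_ultrafilter_of_isBounded {u : Ultrafilter X} (hu : (u : Filter X) ≤ cobounded X)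
    {B : Set X} (hB : IsBounded B) : B ∉ u := fun h =>
  Ultrafilter.compl_notMem_iff.2 h (hu (isBounded_def.1 hB))

theorem diff_mem_ultrafilter_of_isBounded {u : Ultrafilter X} (hu : (u : Filter X) ≤ cobounded X)
    {A B : Set X} (hA : A ∈ u) (hB : IsBounded B) : A \ B ∈ u :=
  Filter.inter_mem hA (hu (isBounded_def.1 hB))

/-- A thickening of a bounded set is bounded. -/
theorem isBounded_of_near {A B : Set X} (hB : IsBounded B) (r : ℝ)
    (h : ∀ a ∈ A, ∃ b ∈ B, dist a b ≤ r) : IsBounded A := by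
  refine (hB.cthickening (δ := r)).subset fun a ha => ?_
  obtain ⟨b, hb, hab⟩ := h a ha
  exact Metric.mem_cthickening_of_dist_le a b r B hb hab

namespace Diverge

variable {A A' B B' D : Set X}

theorem symm (h : Diverge A B) : Diverge B A := fun r =>
  isBounded_of_near (h r) r fun b ⟨hb, a, ha, hab⟩ =>
    ⟨a, ⟨ha, b, hb, by rwa [dist_comm]⟩, hab⟩

theorem mono (h : Diverge A B) (hA : A' ⊆ A) (hB : B' ⊆ B) : Diverge A' B' := fun r =>
  (h r).subset fun _ ⟨ha, b, hb, hab⟩ => ⟨hA ha, b, hB hb, hab⟩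

theorem union_left (h : Diverge A D) (h' : Diverge B D) : Diverge (A ∪ B) D := fun r =>
  ((h r).union (h' r)).subset fun _ ⟨ha, h⟩ => ha.imp (fun ha => ⟨ha, h⟩) fun ha => ⟨ha, h⟩

theorem union_right (h : Diverge D A) (h' : Diverge D B) : Diverge D (A ∪ B) :=
  (h.symm.union_left h'.symm).symm

theorem of_isBounded (h : IsBounded A) : Diverge A B := fun _ => h.subset fun _ h => h.1

theorem empty_right : Diverge A ∅ := (of_isBounded isBounded_empty).symm

theorem isBounded_inter (h : Diverge A B) : IsBounded (A ∩ B) :=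
  (h 0).subset fun a ha => ⟨ha.1, a, ha.2, by simp⟩

/-- Diverging sets have diverging coarse neighbourhoods. -/
theorem exists_between (h : Diverge A B) : ∃ W : Set X, Diverge A Wᶜ ∧ Diverge W B := by
  -- The half-space of points no farther from `A` than from `B`: a point outside it within `r` of `a
  -- ∈ A` has some `b ∈ B` within `r` too, so `dist a b ≤ r + r`.
  refine ⟨{z | ∀ b ∈ B, ∃ a ∈ A, dist z a ≤ dist z b}, fun r => ?_, ?_⟩
  · refine (h (r + r)).subset ?_
    rintro a ⟨ha, z, hz, hr⟩
    simp only [mem_compl_iff, mem_ofPred_eq] at hz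
    push Not at hz
    obtain ⟨b, hb, hzb⟩ := hz
    refine ⟨ha, b, hb, ?_⟩
    have := hzb a ha
    have := dist_triangle a z b
    rw [dist_comm z a] at *
    linarith
  · refine symm fun r => (h.symm (r + r)).subset ?_
    rintro b ⟨hb, z, hz, hr⟩
    obtain ⟨a, ha, hza⟩ := hz b hb
    refine ⟨hb, a, ha, ?_⟩
    have := dist_triangle b z a
    rw [dist_comm z b] at *
    linarith

theorem closure_right (h : Diverge A B) : Diverge A (closure B) := fun r =>
  (h (r + 1)).subset fun a ⟨ha, b, hb, hab⟩ => by
    obtain ⟨c, hc, hbc⟩ := Metric.mem_closure_iff.1 hb 1 one_pos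
    exact ⟨ha, c, hc, by linarith [dist_triangle a b c]⟩

end Diverge

theorem AwayFrom.mono {u : Ultrafilter X} {A B : Set X} (h : AwayFrom u B) (hAB : A ⊆ B) :
    AwayFrom u A :=
  let ⟨U, hU, hUB⟩ := h
  ⟨U, hU, hUB.mono Subset.rfl hAB⟩

theorem AwayFrom.union {u : Ultrafilter X} {A B : Set X} (hA : AwayFrom u A)
    (hB : AwayFrom u B) : AwayFrom u (A ∪ B) :=
  let ⟨U, hU, hUA⟩ := hA
  let ⟨V, hV, hVB⟩ := hB
  ⟨U ∩ V, Filter.inter_mem hU hV,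
    (hUA.mono inter_subset_left Subset.rfl).union_right (hVB.mono inter_subset_right Subset.rfl)⟩

theorem CoarseSeparator.mono {S : Set X} {u : Ultrafilter X} {A B C : Set X}
    (h : CoarseSeparator S u B C) (hAB : A ⊆ B) : CoarseSeparator S u A C := by
  obtain ⟨𝒱₁, 𝒱₂, h1, h2, h3, ⟨V, hV, hBV⟩, h5⟩ := h
  exact ⟨𝒱₁, 𝒱₂, h1, h2, h3, ⟨V, hV, hAB.trans hBV⟩, h5.mono hAB Subset.rfl⟩

theorem CoarseSeparator.closure {S : Set X} {u : Ultrafilter X} {A C : Set X}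
    (h : CoarseSeparator S u A C) : CoarseSeparator S u A (closure C) := by
  obtain ⟨𝒱₁, 𝒱₂, h1, h2, ⟨B, hB, hB1, hBC⟩, h4, h5⟩ := h
  exact ⟨𝒱₁, 𝒱₂, h1, fun D hD hDC => h2 D hD (hDC.mono Subset.rfl subset_closure),
    ⟨B, hB, hB1, hBC.closure_right⟩, h4, h5.closure_right⟩

theorem coarseDimLT_of_isBounded {S : Set X} (hS : IsBounded S) : ∀ n, CoarseDimLT n S
  | 0 => hS
  | _ + 1 => fun _ hu h => absurd h (notMem_ultrafilter_of_isBounded hu hS)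

theorem CoarseDimLT.succ {n : ℕ} : ∀ {S : Set X}, CoarseDimLT n S → CoarseDimLT (n + 1) S := by
  induction n with
  | zero => exact fun h => coarseDimLT_of_isBounded h 1
  | succ n ih =>
    intro S h u hu hS A hA huA
    obtain ⟨C, hC, hsep, hdim⟩ := h u hu hS A hA huA
    exact ⟨C, hC, hsep, ih hdim⟩

theorem CoarseDimLT.mono_nat {m n : ℕ} (hmn : m ≤ n) {S : Set X} (h : CoarseDimLT m S) :
    CoarseDimLT n S := by
  induction hmn with
  | refl => exact h
  | step _ ih => exact ih.succ

-- Subordinations and monotonicity of dimension.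

/-- `p` maps `S` into `C` properly, and displaces the points of `S` that are not isolated at a
given scale by a bounded amount. -/
structure IsSubordination (p : X → X) (S C : Set X) : Prop where
  mapsTo : MapsTo p S C
  displacement : ∀ r : ℝ, ∃ k : ℝ,
    IsBounded {s ∈ S | (∃ s' ∈ S, s' ≠ s ∧ dist s s' ≤ r) ∧ k < dist s (p s)}
  preimage : ∀ B : Set X, IsBounded B → IsBounded (S ∩ p ⁻¹' B)
  image : ∀ B ⊆ S, IsBounded B → IsBounded (p '' B)

namespace IsSubordination

variable {p : X → X} {S C : Set X}

theorem of_subset (h : S ⊆ C) : IsSubordination id S C where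
  mapsTo := fun _ hx => h hx
  displacement := fun r => ⟨0, isBounded_empty.subset fun s hs => by simpa using hs.2.2⟩
  preimage := fun B hB => hB.subset inter_subset_right
  image := fun B _ hB => by simpa using hB

theorem exists_of_closure (S : Set X) : ∃ p : X → X, IsSubordination p (closure S) S := by
  have : ∀ x : X, ∃ y, x ∈ closure S → y ∈ S ∧ dist x y < 1 := fun x => by
    by_cases hx : x ∈ closure S
    · obtain ⟨y, hy⟩ := Metric.mem_closure_iff.1 hx 1 one_pos
      exact ⟨y, fun _ => hy⟩
    · exact ⟨x, fun h => absurd h hx⟩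
  choose p hp using this
  refine ⟨p, fun x hx => (hp x hx).1, fun r => ⟨1, isBounded_empty.subset fun s hs => ?_⟩,
    fun B hB => isBounded_of_near hB 1 fun a ha => ⟨p a, ha.2, (hp a ha.1).2.le⟩,
    fun B hBS hB => isBounded_of_near hB 1 ?_⟩
  · exact absurd hs.2.2 (hp s hs.1).2.le.not_gt
  · rintro _ ⟨b, hb, rfl⟩
    exact ⟨b, hb, by rw [dist_comm]; exact (hp b (hBS hb)).2.le⟩

/-- A subordination is bornologous, up to bounded sets. -/
theorem bornologous (hp : IsSubordination p S C) (r : ℝ) : ∃ R : ℝ,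
    IsBounded {s ∈ S | ∃ s' ∈ S, dist s s' ≤ r ∧ R < dist (p s) (p s')} := by
  obtain ⟨k, hk⟩ := hp.displacement r
  refine ⟨max (k + r + k) 0, isBounded_of_near hk (max r 0) ?_⟩
  rintro s ⟨hs, s', hs', hr, hR⟩
  have hne : s' ≠ s := by
    rintro rfl
    simp at hR
  -- One of `s`, `s'` must move by more than `k`, and each prevents the other from being isolated at
  -- scale `r`.
  by_cases hks : k < dist s (p s)
  · exact ⟨s, ⟨hs, ⟨s', hs', hne, hr⟩, hks⟩, by simp⟩
  · refine ⟨s', ⟨hs', ⟨s, hs, hne.symm, by rwa [dist_comm]⟩, ?_⟩, hr.trans (le_max_left _ _)⟩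
    have h1 := dist_triangle4 (p s) s s' (p s')
    have h2 := (le_max_left _ _).trans_lt hR
    rw [dist_comm (p s) s] at h1
    linarith

theorem diverge_of_mapsTo (hp : IsSubordination p S C) {Z₁ Z₂ V₁ V₂ : Set X} (hV : Diverge V₁ V₂)
    (hZ₁ : Z₁ ⊆ S) (hZ₂ : Z₂ ⊆ S) (h₁ : MapsTo p Z₁ V₁) (h₂ : MapsTo p Z₂ V₂) :
    Diverge Z₁ Z₂ := fun r => by
  obtain ⟨R, hR⟩ := hp.bornologous r
  refine (hR.union (hp.preimage _ (hV R))).subset ?_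
  rintro z ⟨hz, w, hw, hr⟩
  by_cases h : dist (p z) (p w) ≤ R
  · exact Or.inr ⟨hZ₁ hz, h₁ hz, p w, h₂ hw, h⟩
  · exact Or.inl ⟨hZ₁ hz, w, hZ₂ hw, hr, not_le.1 h⟩

/-- A part of `S` that is displaced arbitrarily far diverges from the rest of `S`. -/
theorem diverge_diff (hp : IsSubordination p S C) {B : Set X} (hBS : B ⊆ S)
    (hB : ∀ k : ℝ, IsBounded {b ∈ B | dist b (p b) ≤ k}) : Diverge B (S \ B) := fun r => by
  obtain ⟨k, hk⟩ := hp.displacement r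
  refine (hk.union (hB k)).subset ?_
  rintro b ⟨hb, s, hs, hr⟩
  by_cases h : dist b (p b) ≤ k
  · exact Or.inr ⟨hb, h⟩
  · exact Or.inl ⟨hBS hb, ⟨s, hs.1, fun e => hs.2 (e ▸ hb), hr⟩, not_le.1 h⟩

end IsSubordination

/-- Greedy selection of points of `T`, by increasing value of `f`, so that the points selected
are separated at the scale `f`. -/
theorem exists_greedy (T : Set X) (f : X → ℕ) : ∃ L ⊆ T,
    (∀ s ∈ T, ∃ l ∈ L, dist s l ≤ f s) ∧
    ∀ l ∈ L, ∀ l' ∈ L, l' ≠ l → (f l : ℝ) < dist l l' := by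
  -- Ordering by `f` first makes the test at the later of two selected points imply the one at the
  -- earlier; the well-order only breaks ties.
  let r : X → X → Prop := InvImage (Prod.Lex (· < ·) WellOrderingRel) fun x => (f x, x)
  have hr : WellFounded r := InvImage.wf _ (WellFounded.prod_lex Nat.lt_wfRel.wf
    WellOrderingRel.isWellOrder.wf)
  let P : X → Prop := hr.fix fun s ih => s ∈ T ∧ ∀ l (h : r l s), ih l h → (f s : ℝ) < dist s l
  have hP : ∀ s, P s ↔ s ∈ T ∧ ∀ l, r l s → P l → (f s : ℝ) < dist s l := fun s => by
    exact iff_of_eq (hr.fix_eq _ s)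
  have hlt : ∀ l l', P l → P l' → r l l' →
      (f l : ℝ) < dist l l' ∧ (f l' : ℝ) < dist l' l := fun l l' hl hl' h => by
    have h1 := ((hP l').1 hl').2 l h hl
    refine ⟨?_, h1⟩
    have : f l ≤ f l' := by
      rcases (Prod.lex_iff.1 h) with h | h
      · exact h.le
      · exact h.1.le
    rw [dist_comm]
    exact (Nat.cast_le.2 this).trans_lt h1
  refine ⟨{s | P s}, fun s hs => ((hP s).1 hs).1, fun s hs => ?_, fun l hl l' hl' hne => ?_⟩
  · by_cases h : P s
    · exact ⟨s, h, by simp⟩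
    · rw [hP] at h
      push Not at h
      obtain ⟨l, -, hl, hd⟩ := h hs
      exact ⟨l, hl, hd⟩
  · rcases lt_trichotomy (f l) (f l') with h | h | h
    · exact (hlt l l' hl hl' (Prod.Lex.left _ _ h)).1
    · rcases trichotomous_of WellOrderingRel l l' with h' | h' | h'
      · exact (hlt l l' hl hl' (Prod.lex_iff.2 (Or.inr ⟨h, h'⟩))).1
      · exact absurd h'.symm hne
      · exact (hlt l' l hl' hl (Prod.lex_iff.2 (Or.inr ⟨h.symm, h'⟩))).2
    · exact (hlt l' l hl' hl (Prod.Lex.left _ _ h)).2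

/-- The points of `E` whose image under `p` is at bounded distance from `M` are coarsely contained
in a set subordinate to `M`. -/
theorem IsSubordination.exists_sparse {p : X → X} {S C : Set X} (hp : IsSubordination p S C)
    (o : X) (M : Set X) {E : Set X} (hE : E ⊆ S) : ∃ L ⊆ E, ∃ q, IsSubordination q L M ∧
      ∀ D ⊆ E, Diverge D L → ∀ r : ℝ, IsBounded {z ∈ D | ∃ m ∈ M, dist (p z) m ≤ r} := by
  classical
  let near : ℕ → X → Prop := fun k s => ∃ m ∈ M, dist (p s) m ≤ k
  -- The factor 2 keeps `q` proper: it will move `p s` by at most half of `dist (p s) o`.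
  let T : Set X := {s ∈ E | ∃ k : ℕ, near k s ∧ 2 * (k : ℝ) ≤ dist (p s) o}
  let f : X → ℕ := fun s => sInf {k | near k s}
  have hf : ∀ k s, near k s → f s ≤ k := fun k s h => Nat.sInf_le h
  have hfT : ∀ s ∈ T, near (f s) s ∧ 2 * (f s : ℝ) ≤ dist (p s) o := by
    rintro s ⟨-, k, hk, hko⟩
    refine ⟨Nat.sInf_mem (s := {k | near k s}) ⟨k, hk⟩, le_trans ?_ hko⟩
    have : (f s : ℝ) ≤ k := Nat.cast_le.2 (hf k s hk)
    linarith
  obtain ⟨L, hLT, hnear, hsep⟩ := exists_greedy T f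
  have hq : ∀ s, ∃ m, s ∈ T → m ∈ M ∧ dist (p s) m ≤ f s := fun s => by
    by_cases hs : s ∈ T
    · obtain ⟨m, hm⟩ := (hfT s hs).1
      exact ⟨m, fun _ => hm⟩
    · exact ⟨s, fun h => absurd h hs⟩
  choose q hq using hq
  have hLS : L ⊆ S := fun l hl => hE (hLT hl).1
  refine ⟨L, fun l hl => (hLT hl).1, q, ⟨fun l hl => (hq l (hLT hl)).1, fun r => ?_,
    fun B hB => ?_, fun B hBL hB => ?_⟩, fun D hD hDL r => ?_⟩
  -- Another point of `L` within `r` of `l` forces `f l < r`, so passing from `p l` to `q l` adds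
  -- less than `r` to the displacement.
  · obtain ⟨k, hk⟩ := hp.displacement r
    refine ⟨k + r, hk.subset ?_⟩
    rintro l ⟨hl, ⟨l', hl', hne, hr⟩, hlt⟩
    refine ⟨hLS hl, ⟨l', hLS hl', hne, hr⟩, ?_⟩
    have h1 := hsep l hl l' hl' hne
    have h2 := (hq l (hLT hl)).2
    have h3 := dist_triangle l (p l) (q l)
    linarith
  · obtain ⟨c, hc⟩ := hB.subset_closedBall o
    refine (hp.preimage _ (Metric.isBounded_closedBall (x := o) (r := 2 * c))).subset ?_
    rintro l ⟨hl, hlB⟩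
    refine ⟨hLS hl, ?_⟩
    have h1 : dist (q l) o ≤ c := hc hlB
    have h2 := (hq l (hLT hl)).2
    have h3 := dist_triangle (p l) (q l) o
    have h4 := (hfT l (hLT hl)).2
    show dist (p l) o ≤ 2 * c
    linarith
  · obtain ⟨c, hc⟩ := (hp.image B (hBL.trans hLS) hB).subset_closedBall o
    refine (Metric.isBounded_closedBall (x := o) (r := 2 * c)).subset ?_
    rintro _ ⟨l, hl, rfl⟩
    have h1 : dist (p l) o ≤ c := hc ⟨l, hl, rfl⟩
    have h2 := (hq l (hLT (hBL hl))).2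
    have h3 := dist_triangle_left (q l) o (p l)
    have h4 := (hfT l (hLT (hBL hl))).2
    show dist (q l) o ≤ 2 * c
    linarith [dist_nonneg (x := p l) (y := o)]
  -- If `p z` is within `k` of `M`, then `f z ≤ k` and some selected point is within `k` of `z`,
  -- unless `p z` lies in a fixed ball.
  · obtain ⟨k, hk⟩ := exists_nat_ge r
    refine ((hDL k).union (hp.preimage _
      (Metric.isBounded_closedBall (x := o) (r := 2 * k)))).subset ?_
    rintro z ⟨hz, m, hm, hr⟩
    have hzk : near k z := ⟨m, hm, hr.trans hk⟩
    by_cases h : 2 * (k : ℝ) ≤ dist (p z) o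
    · obtain ⟨l, hl, hd⟩ := hnear z ⟨hD hz, k, hzk, h⟩
      exact Or.inl ⟨hz, l, hl, hd.trans (Nat.cast_le.2 (hf k z hzk))⟩
    · exact Or.inr ⟨hE (hD hz), (not_le.1 h).le⟩

/-- One step of the transfer of separators along a subordination. -/
theorem SeparableAt.of_subordination {n : ℕ} {p : X → X} {S C : Set X}
    (hp : IsSubordination p S C)
    (ih : ∀ (q : X → X) (L M : Set X), IsSubordination q L M → CoarseDimLT n M → CoarseDimLT n L)
    {u : Ultrafilter X} (hu : (u : Filter X) ≤ cobounded X) (hS : S ∈ u)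
    (h : SeparableAt n C (u.map p)) : SeparableAt n S u := by
  rintro A hAS ⟨U₀, hU₀, hU₀A⟩
  -- If `u` and its image are different corona points, `u` lives on points displaced arbitrarily
  -- far; these diverge from the rest of `S`, and the empty set separates. Otherwise a separator for
  -- the image end is pulled back.
  by_cases hsplit : ∃ U ∈ u, ∃ V ∈ u.map p, Diverge U V
  · obtain ⟨U, hU, V, hV, hUV⟩ := hsplit
    have hV' : p ⁻¹' V ∈ u := hV
    set B := ((U ∩ p ⁻¹' V) ∩ (S ∩ U₀)) \ A with hB
    have hBu : B ∈ u := by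
      have h0 : (U ∩ p ⁻¹' V) ∩ (S ∩ U₀) ∈ u :=
        Filter.inter_mem (Filter.inter_mem hU hV') (Filter.inter_mem hS hU₀)
      have h1 := diff_mem_ultrafilter_of_isBounded hu h0 hU₀A.isBounded_inter
      refine Filter.mem_of_superset h1 ?_
      rintro x ⟨hx, hx'⟩
      exact ⟨hx, fun hA => hx' ⟨hx.2.2, hA⟩⟩
    have hBS : B ⊆ S := fun x hx => hx.1.2.1
    have hdiv : Diverge B (S \ B) := hp.diverge_diff hBS fun k =>
      (hUV k).subset fun b hb => ⟨hb.1.1.1.1, p b, hb.1.1.1.2, hb.2⟩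
    refine ⟨∅, empty_subset _, ⟨{V | V ⊆ B}, {V | V ⊆ S \ B},
      fun V₁ h₁ V₂ h₂ => hdiv.mono h₁ h₂, fun D hD _ => ⟨D ∩ B, inter_subset_right, D \ B,
        sdiff_subset_sdiff_left hD, (inter_union_sdiff D B).symm⟩,
      ⟨B, hBu, Subset.rfl, Diverge.empty_right⟩,
      ⟨S \ B, Subset.rfl, fun a ha => ⟨hAS ha, fun hb => hb.2 ha⟩⟩, Diverge.empty_right⟩,
      coarseDimLT_of_isBounded isBounded_empty n⟩
  · push Not at hsplit
    obtain ⟨Wc, hAW, hWU⟩ := hU₀A.symm.exists_between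
    obtain ⟨W, hUW, hWA⟩ := hWU.symm.exists_between
    have hWu : W ∈ u.map p := by
      by_contra hcon
      exact hsplit U₀ hU₀ Wᶜ (Ultrafilter.compl_mem_iff_notMem.2 hcon) hUW
    obtain ⟨M, -, ⟨𝒱₁, 𝒱₂, h12, hcov, ⟨B, hBu, hB1, hBM⟩, ⟨V₀, hV₀, hAV₀⟩, hAM⟩, hdim⟩ :=
      h (Wc ∩ C) inter_subset_right ⟨W, hWu, hWA.mono Subset.rfl inter_subset_left⟩
    obtain ⟨B', hBB', hB'M⟩ := hBM.exists_between
    obtain ⟨A', hAA', hA'M⟩ := hAM.exists_between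
    -- The points of `A` thrown out of its coarse neighbourhood `Wc` diverge from the rest of `S`,
    -- so they can be added to the side of `A` freely.
    set A₂ := A \ p ⁻¹' Wc with hA₂
    have hA₂S : A₂ ⊆ S := fun a ha => hAS ha.1
    have hA₂div : Diverge A₂ (S \ A₂) := hp.diverge_diff hA₂S fun k =>
      (hAW k).subset fun a ha => ⟨ha.1.1, p a, ha.1.2, ha.2⟩
    have hS₁u : S \ A₂ ∈ u := by
      refine Filter.mem_of_superset
        (diff_mem_ultrafilter_of_isBounded hu (Filter.inter_mem hS hU₀) hU₀A.isBounded_inter) ?_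
      rintro x ⟨hx, hx'⟩
      exact ⟨hx.1, fun h => hx' ⟨hx.2, h.1⟩⟩
    obtain ⟨o⟩ : Nonempty X := ⟨(u.nonempty_of_mem hS).some⟩
    -- Points mapped into `B'` or `A'` need no sampling, since these sets diverge from `M`; leaving
    -- them out keeps `L` away from `u` and `A`.
    set E := {s ∈ S \ A₂ | p s ∉ B' ∧ p s ∉ A'} with hE
    have hES : E ⊆ S := fun s hs => hs.1.1
    obtain ⟨L, hLE, q, hq, hL⟩ := hp.exists_sparse o M hES
    have hLS : L ⊆ S := hLE.trans hES
    refine ⟨L, hLS, ⟨{Z | Z ⊆ S \ A₂ ∧ ∃ V ∈ 𝒱₁, MapsTo p Z V},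
      {Z | Z ⊆ S ∧ ∃ V ∈ 𝒱₂, MapsTo p (Z \ A₂) V}, ?_, ?_, ?_, ?_, ?_⟩, ih q L M hq hdim⟩
    · rintro Z₁ ⟨hZ₁, V₁, hV₁, hp₁⟩ Z₂ ⟨hZ₂, V₂, hV₂, hp₂⟩
      have h1 : Diverge Z₁ (Z₂ \ A₂) := hp.diverge_of_mapsTo (h12 V₁ hV₁ V₂ hV₂)
        (hZ₁.trans sdiff_subset) (sdiff_subset.trans hZ₂) hp₁ hp₂
      refine (h1.union_right (hA₂div.symm.mono hZ₁ Subset.rfl)).mono Subset.rfl ?_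
      intro z hz
      by_cases h : z ∈ A₂
      exacts [Or.inr h, Or.inl ⟨hz, h⟩]
    · intro D hDS hDL
      have hpD : Diverge (p '' (D \ A₂)) M := fun r => by
        have hb : IsBounded {z ∈ D \ A₂ | ∃ m ∈ M, dist (p z) m ≤ r} := by
          refine ((hL (D ∩ E) inter_subset_right (hDL.mono inter_subset_left Subset.rfl) r).union
            (hp.preimage _ ((hB'M r).union (hA'M r)))).subset ?_
          rintro z ⟨hz, m, hm, hr⟩
          by_cases hzB : p z ∈ B'
          · exact Or.inr ⟨hDS hz.1, Or.inl ⟨hzB, m, hm, hr⟩⟩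
          by_cases hzA : p z ∈ A'
          · exact Or.inr ⟨hDS hz.1, Or.inr ⟨hzA, m, hm, hr⟩⟩
          exact Or.inl ⟨⟨hz.1, ⟨hDS hz.1, hz.2⟩, hzB, hzA⟩, m, hm, hr⟩
        refine (hp.image _ (fun z hz => hDS hz.1.1) hb).subset ?_
        rintro _ ⟨⟨z, hz, rfl⟩, h⟩
        exact ⟨z, ⟨hz, h⟩, rfl⟩
      obtain ⟨V₁, hV₁, V₂, hV₂, hV⟩ := hcov (p '' (D \ A₂))
        (by rintro _ ⟨z, hz, rfl⟩; exact hp.mapsTo (hDS hz.1)) hpD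
      refine ⟨(D \ A₂) ∩ p ⁻¹' V₁, ⟨fun z hz => ⟨hDS hz.1.1, hz.1.2⟩, V₁, hV₁, fun z hz => hz.2⟩,
        (D \ A₂) ∩ p ⁻¹' V₂ ∪ D ∩ A₂, ⟨?_, V₂, hV₂, ?_⟩, ?_⟩
      · rintro z (hz | hz)
        exacts [hDS hz.1.1, hDS hz.1]
      · rintro z ⟨hz | hz, hz'⟩
        exacts [hz.2, absurd hz.2 hz']
      · ext z
        constructor
        · intro hz
          by_cases hzA : z ∈ A₂
          · exact Or.inr (Or.inr ⟨hz, hzA⟩)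
          · have : p z ∈ V₁ ∪ V₂ := hV ▸ ⟨z, ⟨hz, hzA⟩, rfl⟩
            exact this.imp (fun h => ⟨⟨hz, hzA⟩, h⟩) fun h => Or.inl ⟨⟨hz, hzA⟩, h⟩
        · rintro (hz | hz | hz)
          exacts [hz.1.1, hz.1.1, hz.1]
    · refine ⟨(S \ A₂) ∩ p ⁻¹' B, Filter.inter_mem hS₁u hBu, ⟨inter_subset_left, B, hB1,
        fun z hz => hz.2⟩, hp.diverge_of_mapsTo hBB' (fun z hz => hz.1.1) hLS (fun z hz => hz.2)
        fun l hl => (hLE hl).2.1⟩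
    · exact ⟨A, ⟨hAS, V₀, hV₀, fun a ha => hAV₀
        ⟨not_not.1 fun h => ha.2 ⟨ha.1, h⟩, hp.mapsTo (hAS ha.1)⟩⟩, Subset.rfl⟩
    · have h1 : Diverge (A \ A₂) L := hp.diverge_of_mapsTo hAA' (sdiff_subset.trans hAS) hLS
        (fun a ha => ⟨not_not.1 fun h => ha.2 ⟨ha.1, h⟩, hp.mapsTo (hAS ha.1)⟩)
        fun l hl => (hLE hl).2.2
      refine (h1.union_left (hA₂div.mono Subset.rfl fun l hl => (hLE hl).1)).mono ?_ Subset.rfl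
      intro a ha
      by_cases h : a ∈ A₂
      exacts [Or.inr h, Or.inl ⟨ha, h⟩]

theorem IsSubordination.map_le_cobounded {p : X → X} {S C : Set X} (hp : IsSubordination p S C)
    {u : Ultrafilter X} (hu : (u : Filter X) ≤ cobounded X) (hS : S ∈ u) :
    (u.map p : Filter X) ≤ cobounded X := fun B hB => by
  have h1 := hp.preimage _ (isBounded_compl_iff.2 (isCobounded_def.2 hB))
  have h2 := diff_mem_ultrafilter_of_isBounded hu hS h1
  refine Ultrafilter.mem_map.2 (Filter.mem_of_superset h2 ?_)
  rintro x ⟨hx, hx'⟩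
  exact not_not.1 fun h => hx' ⟨hx, h⟩

/-- Coarse dimension does not increase along a subordination. -/
theorem CoarseDimLT.of_subordination {n : ℕ} : ∀ {p : X → X} {S C : Set X},
    IsSubordination p S C → CoarseDimLT n C → CoarseDimLT n S := by
  induction n with
  | zero =>
    intro p S C hp hC
    exact (hp.preimage C hC).subset fun s hs => ⟨hs, hp.mapsTo hs⟩
  | succ n ih =>
    intro p S C hp hC u hu hS
    exact SeparableAt.of_subordination hp (fun q L M => ih) hu hS
      (hC (u.map p) (hp.map_le_cobounded hu hS) 
        (Ultrafilter.mem_map.2 (Filter.mem_of_superset hS hp.mapsTo)))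

/-- The inclusion is a subordination, but the induction behind it passes through subordinations that
are not inclusions. -/
theorem CoarseDimLT.subset {n : ℕ} {S C : Set X} (h : CoarseDimLT n C) (hSC : S ⊆ C) :
    CoarseDimLT n S :=
  h.of_subordination (.of_subset hSC)

theorem CoarseDimLT.closure {n : ℕ} {S : Set X} (h : CoarseDimLT n S) :
    CoarseDimLT n (closure S) :=
  let ⟨_, hp⟩ := IsSubordination.exists_of_closure S
  h.of_subordination hp

theorem SeparableAt.subset {n : ℕ} {S C : Set X} {u : Ultrafilter X} (h : SeparableAt n C u)
    (hu : (u : Filter X) ≤ cobounded X) (hS : S ∈ u) (hSC : S ⊆ C) : SeparableAt n S u :=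
  SeparableAt.of_subordination (.of_subset hSC) (fun _ _ _ hq hM => hM.of_subordination hq) hu hS
    (by rwa [Ultrafilter.map_id])

-- From finite separators to a uniform bound.

/-- Every sequence of ultrafilters has a cluster point among the ultrafilters. -/
theorem exists_cluster_ultrafilter {α : Type*} (v : ℕ → Ultrafilter α) : ∃ t : Ultrafilter α,
    (∀ V, (∀ n, V ∈ v n) → V ∈ t) ∧ ∀ V ∈ t, ∀ N, ∃ n ≥ N, V ∈ v n := by
  -- The limit of `v` along a free ultrafilter on `ℕ`; freeness makes the indices in the second
  -- claim unbounded.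
  refine ⟨(Filter.hyperfilter ℕ).bind v, fun V hV => ?_, fun V hV N => ?_⟩
  · exact Filter.mem_bind'.2 (Filter.univ_mem' hV)
  · have h1 : {n | V ∈ v n} ∈ (Filter.hyperfilter ℕ : Filter ℕ) := Filter.mem_bind'.1 hV
    have h2 := Filter.nonempty_of_mem
      (Filter.inter_mem h1 (Nat.hyperfilter_le_atTop (Filter.mem_atTop N)))
    obtain ⟨n, hn, hN⟩ := h2
    exact ⟨n, hN, hn⟩

/-- If finite-dimensional separators exist everywhere, then there is no sequence of ends in
mutually diverging neighbourhoods whose boundaries need separators of growing dimension. -/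
theorem not_exists_diverging_sequence
    (hsep : ∀ u : Ultrafilter X, (u : Filter X) ≤ cobounded X → ∀ A, AwayFrom u A →
      ∃ C, CoarseSeparator univ u A C ∧ ∃ n, CoarseDimLT n C)
    (v : ℕ → Ultrafilter X) (hv : ∀ n, (v n : Filter X) ≤ cobounded X) (P W : ℕ → Set X)
    (hP : ∀ n, P n ∈ v n) (hPW : ∀ n, Diverge (P n) (W n)ᶜ)
    (hW : ∀ m n, m < n → Diverge (W n) (W m))
    (hbad : ∀ n C, CoarseSeparator univ (v n) (W n)ᶜ C → ¬ CoarseDimLT n C) : False := by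
  have hW' : ∀ m n, m ≠ n → Diverge (W n) (W m) := fun m n h =>
    (lt_or_gt_of_ne h).elim (hW m n) fun h => (hW n m h).symm
  -- Removing a bounded part of each `W n` puts `Z m` and `Z n` farther than `max m n` apart, so `Z
  -- n` diverges from the union of all the others.
  set Z : ℕ → Set X := fun n => {a ∈ W n | ∀ m < n, ∀ b ∈ W m, (n : ℝ) < dist a b} with hZ
  have hZW : ∀ n, Z n ⊆ W n := fun n a ha => ha.1
  have hWZ : ∀ n, IsBounded (W n \ Z n) := fun n => by
    have : IsBounded (⋃ m ∈ Finset.range n, {a ∈ W n | ∃ b ∈ W m, dist a b ≤ n}) :=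
      (isBounded_biUnion_finset _).2 fun m hm => hW m n (Finset.mem_range.1 hm) n
    refine this.subset ?_
    rintro a ⟨ha, ha'⟩
    simp only [hZ, mem_ofPred_eq, not_and] at ha'
    push Not at ha'
    obtain ⟨m, hm, b, hb, hd⟩ := ha' ha
    simp only [mem_iUnion]
    exact ⟨m, Finset.mem_range.2 hm, ha, b, hb, hd⟩
  have hZdist : ∀ m n, m ≠ n → ∀ a ∈ Z n, ∀ b ∈ Z m, (max m n : ℝ) < dist a b := by
    intro m n hmn a ha b hb
    rcases lt_or_gt_of_ne hmn with h | h
    · rw [max_eq_right (Nat.cast_le.2 h.le)]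
      exact ha.2 m h b hb.1
    · rw [max_eq_left (Nat.cast_le.2 h.le), dist_comm]
      exact hb.2 n h a ha.1
  have hZZ : ∀ n, Diverge (Z n) (⋃ m ∈ ({n}ᶜ : Set ℕ), Z m) := fun n r => by
    obtain ⟨k, hk⟩ := exists_nat_ge r
    have : IsBounded (⋃ m ∈ (Finset.range k).erase n, {a ∈ W n | ∃ b ∈ W m, dist a b ≤ r}) :=
      (isBounded_biUnion_finset _).2 fun m hm => hW' m n (Finset.ne_of_mem_erase hm) r
    refine this.subset ?_
    rintro a ⟨ha, b, hb, hr⟩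
    simp only [mem_iUnion] at hb ⊢
    obtain ⟨m, hm, hb⟩ := hb
    have h1 := hZdist m n hm a ha b hb
    have h2 : (m : ℝ) < k := ((le_max_left _ _).trans_lt h1).trans_le (hr.trans hk)
    exact ⟨m, Finset.mem_erase.2 ⟨hm, Finset.mem_range.2 (Nat.cast_lt.1 h2)⟩, ha.1, b, hb.1, hr⟩
  have hPZ : ∀ n, Diverge (P n) (Z n)ᶜ := fun n => by
    refine ((hPW n).union_right (Diverge.of_isBounded (hWZ n)).symm).mono Subset.rfl ?_
    intro a ha
    by_cases h : a ∈ W n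
    exacts [Or.inr ⟨h, ha⟩, Or.inl h]
  have hZv : ∀ n, Z n ∈ v n := fun n => by
    refine Filter.mem_of_superset
      (diff_mem_ultrafilter_of_isBounded (hv n) (hP n) (hPZ n).isBounded_inter) ?_
    rintro a ⟨ha, ha'⟩
    exact not_not.1 fun h => ha' ⟨ha, h⟩
  -- The growing margin `n` makes the union of the `Q n` diverge from the complement of the union of
  -- the `Z n`.
  set Q : ℕ → Set X := fun n => {a ∈ P n | ∀ b ∈ (Z n)ᶜ, (n : ℝ) < dist a b} with hQ
  have hQv : ∀ n, (⋃ i, Q i) ∈ v n := fun n => by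
    refine Filter.mem_of_superset
      (diff_mem_ultrafilter_of_isBounded (hv n) (hP n) (hPZ n n)) ?_
    rintro a ⟨ha, ha'⟩
    refine mem_iUnion.2 ⟨n, ha, fun b hb => ?_⟩
    by_contra hcon
    exact ha' ⟨ha, b, hb, not_lt.1 hcon⟩
  have hQZ : Diverge (⋃ i, Q i) (⋃ i, Z i)ᶜ := fun r => by
    obtain ⟨k, hk⟩ := exists_nat_ge r
    have : IsBounded (⋃ m ∈ Finset.range k, {a ∈ P m | ∃ b ∈ (Z m)ᶜ, dist a b ≤ r}) :=
      (isBounded_biUnion_finset _).2 fun m hm => hPZ m r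
    refine this.subset ?_
    rintro a ⟨ha, b, hb, hr⟩
    simp only [mem_iUnion, mem_compl_iff, not_exists] at ha hb ⊢
    obtain ⟨i, hi⟩ := ha
    have h1 : (i : ℝ) < k := (hi.2 b (hb i)).trans_le (hr.trans hk)
    exact ⟨i, Finset.mem_range.2 (Nat.cast_lt.1 h1), hi.1, b, hb i, hr⟩
  obtain ⟨t, ht, ht'⟩ := exists_cluster_ultrafilter v
  obtain ⟨C, ⟨𝒱₁, 𝒱₂, h12, hcov, ⟨B, hBt, hB1, hBC⟩, ⟨V₀, hV₀, hZV₀⟩, hZC⟩, m, hm⟩ :=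
    hsep t (fun V hV => ht V fun n => hv n hV) (⋃ i, Z i)ᶜ ⟨_, ht _ hQv, hQZ⟩
  -- An end `v n` on the same side of `C` as `t`, with `n` at least the bound `m` for `C`: the part
  -- of `C` in `Z n` will contradict `hbad n`.
  obtain ⟨n, hn, hBn⟩ := ht' B hBt m
  have hcompl : (Z n)ᶜ ⊆ (⋃ i, Z i)ᶜ ∪ ⋃ m ∈ ({n}ᶜ : Set ℕ), Z m := fun a ha => by
    by_cases h : a ∈ ⋃ i, Z i
    · obtain ⟨i, hi⟩ := mem_iUnion.1 h
      refine Or.inr (mem_iUnion₂.2 ⟨i, ?_, hi⟩)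
      rintro rfl
      exact ha hi
    · exact Or.inl h
  have hCn : Diverge (Z n)ᶜ (C ∩ Z n) :=
    ((hZC.mono Subset.rfl inter_subset_left).union_left
      ((hZZ n).symm.mono Subset.rfl inter_subset_right)).mono hcompl Subset.rfl
  refine hbad n (C ∩ Z n) ⟨{V | V ⊆ Z n ∧ ∃ V₁ ∈ 𝒱₁, V ⊆ V₁}, {V | ∃ V₂ ∈ 𝒱₂, V ⊆ V₂ ∪ (Z n)ᶜ},
    ?_, ?_, ⟨B ∩ Z n, Filter.inter_mem hBn (hZv n), ⟨inter_subset_right, B, hB1,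
      inter_subset_left⟩, hBC.mono inter_subset_left inter_subset_left⟩,
    ⟨(Z n)ᶜ, ⟨V₀, hV₀, subset_union_right⟩, compl_subset_compl.2 (hZW n)⟩,
    hCn.mono (compl_subset_compl.2 (hZW n)) Subset.rfl⟩ ((hm.mono_nat hn).subset inter_subset_left)
  · rintro V ⟨hVZ, V₁, hV₁, hVV₁⟩ V' ⟨V₂, hV₂, hV'⟩
    refine Diverge.mono ?_ Subset.rfl hV'
    refine ((h12 V₁ hV₁ V₂ hV₂).mono hVV₁ Subset.rfl).union_right (Diverge.mono ?_ Subset.rfl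
      hcompl)
    exact ((h12 V₁ hV₁ V₀ hV₀).mono hVV₁ hZV₀).union_right ((hZZ n).mono hVZ Subset.rfl)
  · intro D _ hDC
    have hD : Diverge (D ∩ Z n) C := by
      have h1 : Diverge (D ∩ Z n) (C ∩ (⋃ i, Z i)ᶜ) :=
        (Diverge.of_isBounded (by rw [inter_comm]; exact hZC.isBounded_inter)).symm
      refine ((hDC.mono inter_subset_left Subset.rfl).union_right (h1.union_right
        ((hZZ n).mono inter_subset_right Subset.rfl))).mono Subset.rfl ?_
      intro c hc
      by_cases hcn : c ∈ Z n
      · exact Or.inl ⟨hc, hcn⟩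
      · exact Or.inr ((hcompl hcn).imp (fun h => ⟨hc, h⟩) id)
    obtain ⟨V₁, hV₁, V₂, hV₂, hV⟩ := hcov (D ∩ Z n) (subset_univ _) hD
    have hV1 : V₁ ⊆ D ∩ Z n := hV ▸ subset_union_left
    have hV2 : V₂ ⊆ D ∩ Z n := hV ▸ subset_union_right
    refine ⟨V₁, ⟨fun a ha => (hV1 ha).2, V₁, hV₁, Subset.rfl⟩, V₂ ∪ D \ Z n,
      ⟨V₂, hV₂, union_subset_union_right _ fun a ha => ha.2⟩, ?_⟩
    rw [← union_assoc, ← hV, inter_union_sdiff]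

/-- If every end can be separated from every set away from it by a set of finite coarse dimension,
then the coarse dimension of the whole space is finite. -/
theorem exists_coarseDimLT_univ
    (hsep : ∀ u : Ultrafilter X, (u : Filter X) ≤ cobounded X → ∀ A, AwayFrom u A →
      ∃ C, CoarseSeparator univ u A C ∧ ∃ n, CoarseDimLT n C) :
    ∃ n, CoarseDimLT n (univ : Set X) := by
  by_contra! hcon
  have hbad : ∀ n, ∃ u : Ultrafilter X, (u : Filter X) ≤ cobounded X ∧
      ¬ SeparableAt n univ u := fun n => by
    by_contra! h
    exact hcon (n + 1) fun u hu _ => h u hu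
  have hanti : ∀ m n, m ≤ n → ∀ u : Ultrafilter X, SeparableAt m univ u → SeparableAt n univ u :=
    fun m n hmn u h A hA huA =>
      let ⟨C, hC, h1, h2⟩ := h A hA huA
      ⟨C, hC, h1, h2.mono_nat hmn⟩
  choose u hu hus using hbad
  obtain ⟨y, hy, hy'⟩ := exists_cluster_ultrafilter u
  have hnear : ∀ V ∈ y, ∀ N, ∃ w : Ultrafilter X, (w : Filter X) ≤ cobounded X ∧
      ¬ SeparableAt N univ w ∧ V ∈ w := fun V hV N =>
    let ⟨n, hn, hVn⟩ := hy' V hV N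
    ⟨u n, hu n, fun h => hus n (hanti N n hn _ h), hVn⟩
  have hycob : (y : Filter X) ≤ cobounded X := fun V hV => hy V fun n => hu n hV
  by_cases hI : ∀ N V, AwayFrom y Vᶜ → ∃ w : Ultrafilter X, (w : Filter X) ≤ cobounded X ∧
      ¬ SeparableAt N univ w ∧ V ∈ w ∧ ∃ U ∈ w, ∃ T ∈ y, Diverge U T
  -- Each step picks a bad end in `V` and leaves a smaller neighbourhood `V'` of `y` diverging from
  -- `W`, so all later choices diverge from `W`.
  · have step : ∀ n (V : {V : Set X // AwayFrom y Vᶜ}), ∃ (w : Ultrafilter X) (P W : Set X)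
        (V' : {V : Set X // AwayFrom y Vᶜ}), (w : Filter X) ≤ cobounded X ∧ P ∈ w ∧
        Diverge P Wᶜ ∧ W ⊆ V.1 ∧ V'.1 ⊆ V.1 ∧ Diverge V'.1 W ∧
        ∀ C, CoarseSeparator univ w Wᶜ C → ¬ CoarseDimLT n C := by
      rintro n ⟨V, Y₀, hY₀, hYV⟩
      obtain ⟨V₁, hYV₁, hV₁V⟩ := hYV.exists_between
      obtain ⟨w, hw, hbadw, hV₁w, U, hU, T, hT, hUT⟩ := hI n V₁ ⟨Y₀, hY₀, hYV₁⟩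
      simp only [SeparableAt] at hbadw
      push Not at hbadw
      obtain ⟨A, -, ⟨P₀, hP₀, hP₀A⟩, hno⟩ := hbadw
      obtain ⟨W', hUW', hW'T⟩ := hUT.exists_between
      obtain ⟨V₂, hTV₂, hV₂W'⟩ := hW'T.symm.exists_between
      refine ⟨w, U ∩ V₁ ∩ P₀, (W' ∩ V) \ A, ⟨V₂ ∩ V, ?_⟩, hw,
        Filter.inter_mem (Filter.inter_mem hU hV₁w) hP₀, ?_, fun a ha => ha.1.2,
        inter_subset_right, hV₂W'.mono inter_subset_left fun a ha => ha.1.1, ?_⟩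
      · rw [compl_inter]
        exact AwayFrom.union ⟨T, hT, hTV₂⟩ ⟨Y₀, hY₀, hYV⟩
      · have h1 := hUW'.mono (A' := U ∩ V₁ ∩ P₀) (fun a ha => ha.1.1) Subset.rfl
        have h2 := hV₁V.mono (A' := U ∩ V₁ ∩ P₀) (fun a ha => ha.1.2) Subset.rfl
        have h3 := hP₀A.mono (A' := U ∩ V₁ ∩ P₀) (fun a ha => ha.2) Subset.rfl
        refine ((h1.union_right h2).union_right h3).mono Subset.rfl ?_
        intro a ha
        by_cases haA : a ∈ A
        · exact Or.inr haA
        · rw [← compl_inter]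
          exact Or.inl fun h => ha ⟨h, haA⟩
      · exact fun C hC hdim => hno C (subset_univ _) (hC.mono fun a ha h => h.2 ha) hdim
    choose w P W V' h1 h2 h3 h4 h5 h6 h7 using step
    obtain ⟨V, hV⟩ : ∃ V : ℕ → {V : Set X // AwayFrom y Vᶜ}, ∀ n, V (n + 1) = V' n (V n) :=
      ⟨fun n => Nat.rec ⟨univ, univ, Filter.univ_mem, by rw [compl_univ]; exact .empty_right⟩
        (fun n V => V' n V) n, fun _ => rfl⟩
    have hVanti : Antitone fun n => (V n).1 := antitone_nat_of_succ_le fun n => by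
      rw [hV]
      exact h5 n (V n)
    refine not_exists_diverging_sequence hsep (fun n => w n (V n)) (fun n => h1 n (V n))
      (fun n => P n (V n)) (fun n => W n (V n)) (fun n => h2 n (V n)) (fun n => h3 n (V n))
      (fun m n hmn => ?_) (fun n => h7 n (V n))
    refine (h6 m (V m)).mono ((h4 n (V n)).trans ?_) Subset.rfl
    rw [← hV]
    exact hVanti (Nat.succ_le_of_lt hmn)
  · push Not at hI
    obtain ⟨N, V, ⟨Y₀, hY₀, hYV⟩, hyw⟩ := hI
    obtain ⟨w, hw, hbadw, hw'⟩ := hnear (Y₀ \ Vᶜ)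
      (Filter.mem_of_superset
        (diff_mem_ultrafilter_of_isBounded hycob hY₀ hYV.isBounded_inter)
        fun a ha => ⟨ha.1, fun h => ha.2 ⟨ha.1, h⟩⟩) (N + 1)
    have hVw : V ∈ w := Filter.mem_of_superset hw' fun a ha => not_not.1 ha.2
    have hY₀w : Y₀ ∈ w := Filter.mem_of_superset hw' fun a ha => ha.1
    refine hbadw fun A _ hA => ?_
    -- Adding `Vᶜ` to `A` forces every end of `C` to contain `V`; the dimension of `C` is then
    -- bounded by showing these ends good at level `N`.
    obtain ⟨C, hC, -⟩ := hsep w hw (A ∪ Vᶜ) (hA.union ⟨Y₀, hY₀w, hYV⟩)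
    refine ⟨C, subset_univ _, hC.mono subset_union_left, fun t ht hCt => ?_⟩
    obtain ⟨-, -, -, -, ⟨B, hBw, -, hBC⟩, -, hAC⟩ := hC
    have hVt : V ∈ t := by
      have h := (hAC.mono (A' := Vᶜ) subset_union_right Subset.rfl).isBounded_inter
      refine Filter.mem_of_superset (diff_mem_ultrafilter_of_isBounded ht hCt h) ?_
      rintro a ⟨ha, ha'⟩
      exact not_not.1 fun h => ha' ⟨h, ha⟩
    have hgood : SeparableAt N univ t := by
      by_contra hbadt
      -- `D` distinguishes `w` from `t`, so one of these two bad ends differs from `y`.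
      obtain ⟨D, hBD, hDC⟩ := hBC.exists_between
      by_cases hD : D ∈ y
      · exact hyw t ht hbadt hVt C hCt D hD hDC.symm
      · exact hyw w hw (fun h => hbadw (hanti N _ N.le_succ w h)) hVw B hBw Dᶜ
          (Ultrafilter.compl_mem_iff_notMem.2 hD) hBD
    exact hgood.subset ht hCt (subset_univ _)

end Coarse

-- Translation between the Higson corona and divergence.

section Corona

open Filter Topology

variable {X : Type*} [MetricSpace X]

theorem continuous_higsonMap : Continuous (higsonMap X) :=
  continuous_pi fun φ => φ.1.continuous

/-- A compactly supported bump function around `a`, as a Higson function. -/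
theorem exists_bump (a : X) : ∃ φ : HigsonFunction X, φ.1 a = 1 ∧
    ∀ z, 1 ≤ dist z a → φ.1 z = 0 := by
  let f : X → unitInterval := fun z => ⟨max 0 (1 - dist z a), le_max_left _ _,
    max_le zero_le_one (by linarith [dist_nonneg (x := z) (y := a)])⟩
  have hf : Continuous f := by
    refine Continuous.subtype_mk ?_ _
    fun_prop
  have hf0 : ∀ z, 1 ≤ dist z a → f z = 0 := fun z hz =>
    Subtype.ext (max_eq_left (by linarith))
  refine ⟨⟨⟨f, hf⟩, fun r hr ε hε => ?_⟩, Subtype.ext (by simp [f]), hf0⟩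
  have hb : (Metric.closedBall a (1 + r))ᶜ ∈ cobounded X :=
    isBounded_def.1 Metric.isBounded_closedBall
  filter_upwards [hb] with x hx
  have hsub : (f '' Metric.ball x r).Subsingleton := by
    have : ∀ z ∈ Metric.ball x r, f z = 0 := fun z hz => hf0 z <| by
      have h1 : 1 + r < dist x a := not_le.1 hx
      have h2 : dist z x < r := hz
      have h3 := dist_triangle_left x a z
      linarith
    rintro _ ⟨z, hz, rfl⟩ _ ⟨w, hw, rfl⟩
    rw [this z hz, this w hw]
  show Metric.diam (f '' Metric.ball x r) < ε
  rw [Metric.diam_subsingleton hsub]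
  exact hε

theorem closure_image_subset_range_of_isBounded [ProperSpace X] {A : Set X} (hA : IsBounded A) :
    closure (higsonMap X '' A) ⊆ range (higsonMap X) := by
  have h : IsCompact (higsonMap X '' closure A) :=
    hA.isCompact_closure.image continuous_higsonMap
  exact (closure_minimal (image_mono subset_closure) h.isClosed).trans (image_subset_range _ _)

/-- The ultrafilter `u` on `X` converges to the point `x` of the corona. -/
def Represents (u : Ultrafilter X) (x : higsonCorona X) : Prop :=
  (u : Filter X) ≤ cobounded X ∧ Tendsto (higsonMap X) u (𝓝 x.1)

theorem notMem_range_of_tendsto {u : Ultrafilter X} (hu : (u : Filter X) ≤ cobounded X)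
    {x : HigsonFunction X → unitInterval} (hx : Tendsto (higsonMap X) u (𝓝 x)) :
    x ∉ range (higsonMap X) := by
  rintro ⟨a, rfl⟩
  obtain ⟨φ, h1, h0⟩ := exists_bump a
  have h2 : Tendsto (fun z => φ.1 z) u (𝓝 (φ.1 a)) := (tendsto_pi_nhds.1 hx) φ
  have h3 : ∀ᶠ z in (u : Filter X), φ.1 z = 0 := by
    have hb : (Metric.closedBall a 1)ᶜ ∈ (u : Filter X) :=
      hu (isBounded_def.1 Metric.isBounded_closedBall)
    filter_upwards [hb] with z hz
    rw [mem_compl_iff, Metric.mem_closedBall, not_le] at hz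
    exact h0 z hz.le
  have h4 := tendsto_nhds_unique h2 (tendsto_const_nhds.congr' (h3.mono fun _ h => h.symm))
  rw [h1] at h4
  exact one_ne_zero h4

theorem exists_represented {u : Ultrafilter X} (hu : (u : Filter X) ≤ cobounded X) :
    ∃ x : higsonCorona X, Represents u x := by
  obtain ⟨x, -, hx⟩ := isCompact_univ.ultrafilter_le_nhds (u.map (higsonMap X)) (by simp)
  have hx' : Tendsto (higsonMap X) u (𝓝 x) := hx
  exact ⟨⟨x, mem_closure_of_tendsto hx' (Eventually.of_forall fun z => mem_range_self z),
    notMem_range_of_tendsto hu hx'⟩, hu, hx'⟩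

/-- In a proper space, an ultrafilter containing a bounded set has its limit in `X`, so one
converging to a corona point escapes to infinity. -/
theorem exists_represents_of_mem_trace [ProperSpace X] {A : Set X} {x : higsonCorona X}
    (hx : x ∈ higsonTrace A) : ∃ u : Ultrafilter X, Represents u x ∧ A ∈ u := by
  obtain ⟨u, hAu, hu⟩ : ∃ u : Ultrafilter X, A ∈ u ∧ Tendsto (higsonMap X) u (𝓝 x.1) := by
    have h : NeBot (comap (higsonMap X) (𝓝 x.1) ⊓ 𝓟 A) := by
      have hx' : NeBot (𝓝 x.1 ⊓ 𝓟 (higsonMap X '' A)) := mem_closure_iff_clusterPt.1 hx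
      rw [← map_principal, ← Filter.push_pull', map_neBot_iff] at hx'
      exact hx'
    obtain ⟨u, hu⟩ := Ultrafilter.exists_le (comap (higsonMap X) (𝓝 x.1) ⊓ 𝓟 A)
    exact ⟨u, le_principal_iff.1 (hu.trans inf_le_right),
      tendsto_iff_comap.2 (hu.trans inf_le_left)⟩
  refine ⟨u, ⟨fun B hB => ?_, hu⟩, hAu⟩
  by_contra hcon
  have h1 : Bᶜ ∈ u := Ultrafilter.compl_mem_iff_notMem.2 hcon
  have h2 : x.1 ∈ closure (higsonMap X '' Bᶜ) :=
    mem_closure_of_tendsto hu (Filter.mem_of_superset h1 fun z hz => mem_image_of_mem _ hz)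
  exact x.2.2 (closure_image_subset_range_of_isBounded
    (isBounded_compl_iff.2 (isCobounded_def.2 hB)) h2)

theorem exists_represents [ProperSpace X] (x : higsonCorona X) :
    ∃ u : Ultrafilter X, Represents u x := by
  have hx : x ∈ higsonTrace (univ : Set X) := by
    show x.1 ∈ closure (higsonMap X '' univ)
    rw [image_univ]
    exact x.2.1
  obtain ⟨u, hu, -⟩ := exists_represents_of_mem_trace hx
  exact ⟨u, hu⟩

theorem Represents.mem_trace {u : Ultrafilter X} {x : higsonCorona X} (h : Represents u x)
    {A : Set X} (hA : A ∈ u) : x ∈ higsonTrace A :=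
  mem_closure_of_tendsto h.2 (Filter.mem_of_superset hA fun _ hz => mem_image_of_mem _ hz)

/-- The bump function at `a` vanishes on the corona and equals 1 at `a`, so no point of `X` is a
limit of the corona. -/
theorem isClosed_higsonCorona [ProperSpace X] : IsClosed (higsonCorona X) := by
  refine isClosed_of_closure_subset fun y hy => ⟨?_, ?_⟩
  · exact closure_minimal (fun z hz => hz.1) isClosed_closure hy
  · rintro ⟨a, rfl⟩
    obtain ⟨φ, h1, h0⟩ := exists_bump a
    have hsub : higsonCorona X ⊆ {z | z φ = 0} := fun z hz => by
      obtain ⟨u, hu, hu'⟩ := exists_represents ⟨z, hz⟩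
      have h2 : Tendsto (fun w => φ.1 w) u (𝓝 (z φ)) := (tendsto_pi_nhds.1 hu') φ
      have hb : (Metric.closedBall a 1)ᶜ ∈ (u : Filter X) :=
        hu (isBounded_def.1 Metric.isBounded_closedBall)
      refine tendsto_nhds_unique h2 (tendsto_const_nhds.congr' ?_)
      filter_upwards [hb] with w hw
      rw [mem_compl_iff, Metric.mem_closedBall, not_le] at hw
      exact (h0 w hw.le).symm
    have h3 := closure_minimal hsub (isClosed_singleton.preimage (continuous_apply φ)) hy
    exact one_ne_zero (h1.symm.trans h3)

instance [ProperSpace X] : CompactSpace (higsonCorona X) :=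
  isCompact_iff_compactSpace.1 isClosed_higsonCorona.isCompact

theorem isClosed_higsonTrace (A : Set X) : IsClosed (higsonTrace A) :=
  isClosed_closure.preimage continuous_subtype_val

theorem higsonTrace_mono {A B : Set X} (h : A ⊆ B) : higsonTrace A ⊆ higsonTrace B := fun _ hx =>
  closure_mono (image_mono h) hx

theorem higsonTrace_union (A B : Set X) : higsonTrace (A ∪ B) = higsonTrace A ∪ higsonTrace B := by
  ext x
  simp only [higsonTrace, image_union, closure_union]
  rfl

/-- Diverging sets are separated by a Higson function. -/
theorem Diverge.exists_higsonFunction {A B : Set X} (h : Diverge A B) (hA : A.Nonempty)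
    (hB : B.Nonempty) : ∃ φ : HigsonFunction X, (∀ a ∈ A, φ.1 a = 0) ∧
      IsBounded {b ∈ B | φ.1 b ≠ 1} := by
  -- Denominator of Urysohn's quotient; divergence makes it tend to infinity, which gives slow
  -- oscillation. The maximum with 1 keeps it positive and affects the value 1 only at points of `B`
  -- within distance 1 of `A`.
  set σ : X → ℝ := fun z => max (Metric.infDist z A + Metric.infDist z B) 1 with hσ
  have hσ1 : ∀ z, 1 ≤ σ z := fun z => le_max_right _ _
  have hAσ : ∀ z, Metric.infDist z A ≤ σ z := fun z =>
    (le_add_of_nonneg_right Metric.infDist_nonneg).trans (le_max_left _ _)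
  let f : X → unitInterval := fun z => ⟨Metric.infDist z A / σ z,
    div_nonneg Metric.infDist_nonneg (zero_le_one.trans (hσ1 z)),
    div_le_one_of_le₀ (hAσ z) (zero_le_one.trans (hσ1 z))⟩
  have hσc : Continuous σ := 
    ((Metric.continuous_infDist_pt A).add (Metric.continuous_infDist_pt B)).max continuous_const
  have hf : Continuous f := Continuous.subtype_mk
    ((Metric.continuous_infDist_pt A).div hσc fun z => (zero_lt_one.trans_le (hσ1 z)).ne') _
  have hσlim : ∀ R : ℝ, IsBounded {z | σ z ≤ R} := fun R => by
    refine isBounded_of_near (h (R + R + 2)) (R + 1) fun z hz => ?_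
    have h1 : Metric.infDist z A + Metric.infDist z B ≤ R := (le_max_left _ _).trans hz
    have h2 : Metric.infDist z A < R + 1 := by
      linarith [Metric.infDist_nonneg (x := z) (s := B)]
    have h3 : Metric.infDist z B < R + 1 := by
      linarith [Metric.infDist_nonneg (x := z) (s := A)]
    obtain ⟨a, ha, hza⟩ := (Metric.infDist_lt_iff hA).1 h2
    obtain ⟨b, hb, hzb⟩ := (Metric.infDist_lt_iff hB).1 h3
    exact ⟨a, ⟨ha, b, hb, by linarith [dist_triangle_left a b z]⟩, hza.le⟩
  have hosc : ∀ z w, |Metric.infDist z A / σ z - Metric.infDist w A / σ w| ≤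
      3 * dist z w / σ z := fun z w => by
    have hz := zero_lt_one.trans_le (hσ1 z)
    have hw := zero_lt_one.trans_le (hσ1 w)
    have hAd : |Metric.infDist z A - Metric.infDist w A| ≤ dist z w := by
      have := (Metric.lipschitz_infDist_pt A).dist_le_mul z w
      simpa [Real.dist_eq] using this
    have hBd : |Metric.infDist z B - Metric.infDist w B| ≤ dist z w := by
      have := (Metric.lipschitz_infDist_pt B).dist_le_mul z w
      simpa [Real.dist_eq] using this
    have hσd : |σ w - σ z| ≤ 2 * dist z w := by
      rw [abs_sub_comm]
      refine (abs_max_sub_max_le_abs _ _ _).trans ?_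
      rw [abs_le] at *
      constructor <;> linarith [hAd.1, hAd.2, hBd.1, hBd.2]
    have e : Metric.infDist z A / σ z - Metric.infDist w A / σ w =
        ((Metric.infDist z A - Metric.infDist w A) +
          Metric.infDist w A / σ w * (σ w - σ z)) / σ z := by
      field_simp
      ring
    rw [e, abs_div, abs_of_pos hz]
    gcongr
    refine (abs_add_le _ _).trans ?_
    rw [abs_mul]
    have h1 : |Metric.infDist w A / σ w| ≤ 1 := by
      rw [abs_of_nonneg (div_nonneg Metric.infDist_nonneg hw.le)]
      exact div_le_one_of_le₀ (hAσ w) hw.le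
    nlinarith [abs_nonneg (σ w - σ z)]
  refine ⟨⟨⟨f, hf⟩, fun r hr ε hε => ?_⟩, fun a ha => Subtype.ext ?_, ?_⟩
  -- Beyond this bound `3 * r / σ x < ε / 4`, so the image of the ball has diameter at most `ε / 2`.
  · have hb : {z | σ z ≤ 12 * r / ε}ᶜ ∈ cobounded X := isBounded_def.1 (hσlim _)
    filter_upwards [hb] with x hx
    have hx' : 12 * r / ε < σ x := not_le.1 hx
    have hxε : 12 * r < σ x * ε := (div_lt_iff₀ hε).1 hx'
    have hσx := zero_lt_one.trans_le (hσ1 x)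
    have hd : ∀ z ∈ Metric.ball x r, dist (f x) (f z) ≤ ε / 4 := fun z hz => by
      rw [Subtype.dist_eq, Real.dist_eq]
      refine (hosc x z).trans ?_
      rw [div_le_iff₀ hσx]
      have : dist x z < r := by rw [dist_comm]; exact hz
      linarith
    refine (Metric.diam_le_of_forall_dist_le (C := ε / 2) (by positivity) ?_).trans_lt
      (by linarith)
    rintro _ ⟨z, hz, rfl⟩ _ ⟨w, hw, rfl⟩
    show dist (f z) (f w) ≤ _
    linarith [dist_triangle_left (f z) (f w) (f x), hd z hz, hd w hw]
  · show Metric.infDist a A / σ a = 0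
    rw [Metric.infDist_zero_of_mem ha, zero_div]
  · refine (h.symm 1).subset ?_
    rintro b ⟨hb, hne⟩
    refine ⟨hb, ?_⟩
    by_contra hcon
    push Not at hcon
    have h1 : 1 ≤ Metric.infDist b A := (Metric.le_infDist hA).2 fun {a} ha => (hcon a ha).le
    refine hne (Subtype.ext ?_)
    show Metric.infDist b A / σ b = 1
    rw [hσ]
    simp only [Metric.infDist_zero_of_mem hb, add_zero, max_eq_left h1]
    exact div_self (by linarith)

/-- Two sets diverge if and only if their traces in the corona are disjoint. -/
theorem diverge_iff_disjoint_trace [ProperSpace X] {A B : Set X} :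
    Diverge A B ↔ Disjoint (higsonTrace A) (higsonTrace B) := by
  refine ⟨fun h => disjoint_left.2 fun x hxA hxB => ?_, fun h r => ?_⟩
  · obtain ⟨u, hu, hAu⟩ := exists_represents_of_mem_trace hxA
    obtain ⟨w, hw, hBw⟩ := exists_represents_of_mem_trace hxB
    obtain ⟨φ, h0, h1⟩ := h.exists_higsonFunction (u.nonempty_of_mem hAu) (w.nonempty_of_mem hBw)
    have hux : Tendsto (fun z => φ.1 z) u (𝓝 (x.1 φ)) := (tendsto_pi_nhds.1 hu.2) φ
    have hwx : Tendsto (fun z => φ.1 z) w (𝓝 (x.1 φ)) := (tendsto_pi_nhds.1 hw.2) φ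
    have e0 : x.1 φ = 0 := tendsto_nhds_unique hux (tendsto_const_nhds.congr'
      (Filter.mem_of_superset hAu fun a ha => (h0 a ha).symm))
    have e1 : x.1 φ = 1 := tendsto_nhds_unique hwx (tendsto_const_nhds.congr'
      (Filter.mem_of_superset (diff_mem_ultrafilter_of_isBounded hw.1 hBw h1)
        fun b hb => (not_not.1 fun hne => hb.2 ⟨hb.1, hne⟩).symm))
    exact zero_ne_one (e0.symm.trans e1)
  · by_contra hcon
    set E := {a ∈ A | ∃ b ∈ B, dist a b ≤ r} with hE
    have hne : NeBot (cobounded X ⊓ 𝓟 E) := by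
      rw [neBot_iff, Ne, inf_principal_eq_bot]
      exact fun h => hcon (isBounded_def.2 h)
    obtain ⟨u, hu⟩ := Ultrafilter.exists_le (cobounded X ⊓ 𝓟 E)
    have hEu : E ∈ u := le_principal_iff.1 (hu.trans inf_le_right)
    obtain ⟨x, hx⟩ := exists_represented (hu.trans inf_le_left)
    have hb : ∀ a, ∃ b, a ∈ E → b ∈ B ∧ dist a b ≤ r := fun a => by
      by_cases ha : a ∈ E
      · obtain ⟨b, hb⟩ := ha.2
        exact ⟨b, fun _ => hb⟩
      · exact ⟨a, fun h => absurd h ha⟩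
    choose p hp using hb
    -- Moving by at most `r` does not change limits of slowly oscillating functions, so `x` lies in
    -- the trace of `B` as well.
    have hpx : Tendsto (fun a => higsonMap X (p a)) u (𝓝 x.1) := by
      refine tendsto_pi_nhds.2 fun φ => ?_
      have h1 : Tendsto (fun z => φ.1 z) u (𝓝 (x.1 φ)) := (tendsto_pi_nhds.1 hx.2) φ
      refine (tendsto_iff_of_dist ?_).1 h1
      rw [Metric.tendsto_nhds]
      intro ε hε
      have hosc := hx.1 (φ.2 (max r 0 + 1) (by positivity) ε hε)
      filter_upwards [hosc, hEu] with a ha haE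
      rw [Real.dist_0_eq_abs, abs_of_nonneg dist_nonneg]
      refine lt_of_le_of_lt (Metric.dist_le_diam_of_mem (Metric.isBounded_of_compactSpace) ?_ ?_) ha
      · exact mem_image_of_mem _ (Metric.mem_ball_self (by positivity))
      · refine mem_image_of_mem _ ?_
        rw [Metric.mem_ball, dist_comm]
        linarith [(hp a haE).2, le_max_left r 0]
    refine disjoint_left.1 h (hx.mem_trace (Filter.mem_of_superset hEu fun a ha => ha.1)) ?_
    exact mem_closure_of_tendsto hpx
      (Filter.mem_of_superset hEu fun a ha => mem_image_of_mem _ (hp a ha).1)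

/-- Disjoint closed subsets of the corona are separated by the trace of a set whose complement has
trace disjoint from the first. -/
theorem exists_trace_between [ProperSpace X] {F G : Set (higsonCorona X)} (hF : IsClosed F)
    (hG : IsClosed G) (hFG : Disjoint F G) : ∃ D : Set X, Disjoint F (higsonTrace Dᶜ) ∧
      Disjoint (higsonTrace D) G := by
  obtain ⟨O, O', hO, hO', hFO, hGO, hOO⟩ := SeparatedNhds.of_isCompact_isCompact
    (hF.isCompact.image continuous_subtype_val) (hG.isCompact.image continuous_subtype_val)
    ((disjoint_image_iff Subtype.val_injective).2 hFG)
  refine ⟨higsonMap X ⁻¹' O, disjoint_left.2 fun x hx hx' => ?_,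
    disjoint_left.2 fun x hx hx' => ?_⟩
  · have : closure (higsonMap X '' (higsonMap X ⁻¹' O)ᶜ) ⊆ Oᶜ :=
      closure_minimal (by rintro _ ⟨z, hz, rfl⟩; exact hz) hO.isClosed_compl
    exact this hx' (hFO (mem_image_of_mem _ hx))
  · have : closure (higsonMap X '' (higsonMap X ⁻¹' O)) ⊆ O'ᶜ :=
      closure_minimal (by rintro _ ⟨z, hz, rfl⟩; exact disjoint_left.1 hOO hz) hO'.isClosed_compl
    exact this hx (hGO (mem_image_of_mem _ hx'))

theorem mem_trace_or [ProperSpace X] (D : Set X) (x : higsonCorona X) :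
    x ∈ higsonTrace D ∨ x ∈ higsonTrace Dᶜ := by
  obtain ⟨u, hu⟩ := exists_represents x
  exact (u.mem_or_compl_mem D).imp hu.mem_trace hu.mem_trace

theorem Represents.mem_of_notMem_trace {u : Ultrafilter X} {x : higsonCorona X}
    (h : Represents u x) {D : Set X} (hD : x ∉ higsonTrace Dᶜ) : D ∈ u := by
  by_contra hcon
  exact hD (h.mem_trace (Ultrafilter.compl_mem_iff_notMem.2 hcon))

theorem Represents.awayFrom_iff [ProperSpace X] {u : Ultrafilter X} {x : higsonCorona X}
    (h : Represents u x) {A : Set X} : AwayFrom u A ↔ x ∉ higsonTrace A := by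
  constructor
  · rintro ⟨U, hU, hUA⟩ hx
    exact disjoint_left.1 (diverge_iff_disjoint_trace.1 hUA) (h.mem_trace hU) hx
  · intro hx
    obtain ⟨D, hxD, hDA⟩ := exists_trace_between isClosed_singleton (isClosed_higsonTrace A)
      (disjoint_singleton_left.2 hx)
    exact ⟨D, h.mem_of_notMem_trace (disjoint_singleton_left.1 hxD),
      diverge_iff_disjoint_trace.2 hDA⟩

/-- Asymptotic separators, described without the corona. -/
theorem Represents.isAsymptoticSeparator_iff [ProperSpace X] {u : Ultrafilter X}
    {x : higsonCorona X} (h : Represents u x)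
    {A C : Set X} :
    IsAsymptoticSeparator x A C ↔ CoarseSeparator univ u A C := by
  constructor
  · rintro ⟨U₁, U₂, hU₁, hU₂, hU, hC, hx, hA⟩
    have hC1 : ∀ {D}, higsonTrace D ⊆ U₁ → Disjoint (higsonTrace D) (higsonTrace C) :=
      fun hD => disjoint_left.2 fun y hy hyC =>
        (hC.symm ▸ Or.inl (hD hy) : y ∈ (higsonTrace C)ᶜ) hyC
    have hC2 : ∀ {D}, higsonTrace D ⊆ U₂ → Disjoint (higsonTrace D) (higsonTrace C) :=
      fun hD => disjoint_left.2 fun y hy hyC =>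
        (hC.symm ▸ Or.inr (hD hy) : y ∈ (higsonTrace C)ᶜ) hyC
    refine ⟨{D | higsonTrace D ⊆ U₁}, {D | higsonTrace D ⊆ U₂}, fun V₁ h₁ V₂ h₂ =>
      diverge_iff_disjoint_trace.2 (hU.mono h₁ h₂), fun D _ hDC => ?_, ?_,
      ⟨A, hA, Subset.rfl⟩, diverge_iff_disjoint_trace.2 (hC2 hA)⟩
    · have hD : higsonTrace D ⊆ U₁ ∪ U₂ := hC ▸
        disjoint_left.1 (diverge_iff_disjoint_trace.1 hDC)
      -- The parts of the trace of `D` in `U₁` and in `U₂` are disjoint closed sets, and `E` cuts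
      -- `D` accordingly.
      obtain ⟨E, hE1, hE2⟩ := exists_trace_between
        (F := higsonTrace D ∩ U₂ᶜ) (G := higsonTrace D ∩ U₁ᶜ)
        ((isClosed_higsonTrace D).inter hU₂.isClosed_compl)
        ((isClosed_higsonTrace D).inter hU₁.isClosed_compl)
        (disjoint_left.2 fun y hy hy' => (hD hy.1).elim hy'.2 hy.2)
      refine ⟨D ∩ E, fun y hy => ?_, D \ E, fun y hy => ?_, (inter_union_sdiff D E).symm⟩
      · by_contra hyU
        exact disjoint_left.1 hE2 (higsonTrace_mono inter_subset_right hy)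
          ⟨higsonTrace_mono inter_subset_left hy, hyU⟩
      · by_contra hyU
        exact disjoint_left.1 hE1 ⟨higsonTrace_mono sdiff_subset hy, hyU⟩
          (higsonTrace_mono (fun a ha => ha.2) hy)
    · obtain ⟨B, hxB, hBU⟩ := exists_trace_between isClosed_singleton hU₁.isClosed_compl
        (disjoint_compl_right_iff_subset.2 hx)
      have hB : higsonTrace B ⊆ U₁ := disjoint_compl_right_iff_subset.1 hBU
      exact ⟨B, h.mem_of_notMem_trace (disjoint_singleton_left.1 hxB), hB,
        diverge_iff_disjoint_trace.2 (hC1 hB)⟩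
  · rintro ⟨𝒱₁, 𝒱₂, h12, hcov, ⟨B, hBu, hB, hBC⟩, ⟨V₀, hV₀, hAV₀⟩, hAC⟩
    -- Traces are only closed; the complement of the trace of `Vᶜ` is an open set inside the trace
    -- of `V`.
    let U : Set (Set X) → Set (higsonCorona X) := fun 𝒱 =>
      ⋃ V ∈ {V ∈ 𝒱 | Diverge V C}, (higsonTrace Vᶜ)ᶜ
    have hUo : ∀ 𝒱, IsOpen (U 𝒱) := fun 𝒱 =>
      isOpen_biUnion fun V _ => (isClosed_higsonTrace _).isOpen_compl
    have hUmem : ∀ {𝒱 y}, y ∈ U 𝒱 → ∃ V ∈ 𝒱, Diverge V C ∧ y ∈ higsonTrace V := by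
      intro 𝒱 y hy
      obtain ⟨V, ⟨hV, hVC⟩, hyV⟩ := mem_iUnion₂.1 hy
      exact ⟨V, hV, hVC, (mem_trace_or V y).resolve_right hyV⟩
    have hdisj : ∀ {V₁ V₂ y}, V₁ ∈ 𝒱₁ → V₂ ∈ 𝒱₂ → y ∈ higsonTrace V₁ → y ∉ higsonTrace V₂ :=
      fun h₁ h₂ hy => disjoint_left.1 (diverge_iff_disjoint_trace.1 (h12 _ h₁ _ h₂)) hy
    have hcovU : ∀ y, y ∉ higsonTrace C → y ∈ U 𝒱₁ ∪ U 𝒱₂ := fun y hy => by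
      obtain ⟨D, hyD, hDC⟩ := exists_trace_between isClosed_singleton (isClosed_higsonTrace C)
        (disjoint_singleton_left.2 hy)
      rw [disjoint_singleton_left] at hyD
      have hDC' := diverge_iff_disjoint_trace.2 hDC
      obtain ⟨V₁, h₁, V₂, h₂, rfl⟩ := hcov D (subset_univ _) hDC'
      have key : ∀ V V' : Set X, y ∉ higsonTrace (V ∪ V')ᶜ → y ∉ higsonTrace V' →
          y ∈ (higsonTrace Vᶜ)ᶜ := fun V V' hVV hV' hyV => by
        have : y ∈ higsonTrace ((V ∪ V')ᶜ ∪ V') := by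
          refine higsonTrace_mono (fun a ha => ?_) hyV
          by_cases haV : a ∈ V'
          · exact Or.inr haV
          · exact Or.inl fun h => h.elim ha haV
        rw [higsonTrace_union] at this
        exact this.elim hVV hV'
      by_cases hy2 : y ∈ higsonTrace V₂
      · refine Or.inr (mem_iUnion₂.2 ⟨V₂, ⟨h₂, hDC'.mono subset_union_right Subset.rfl⟩, ?_⟩)
        exact key V₂ V₁ (by rwa [union_comm]) fun hy1 => hdisj h₁ h₂ hy1 hy2
      · exact Or.inl (mem_iUnion₂.2 ⟨V₁, ⟨h₁, hDC'.mono subset_union_left Subset.rfl⟩,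
          key V₁ V₂ hyD hy2⟩)
    refine ⟨U 𝒱₁, U 𝒱₂, hUo _, hUo _, disjoint_left.2 fun y hy hy' => ?_, ?_, ?_, ?_⟩
    · obtain ⟨V₁, h₁, -, hy₁⟩ := hUmem hy
      obtain ⟨V₂, h₂, -, hy₂⟩ := hUmem hy'
      exact hdisj h₁ h₂ hy₁ hy₂
    · refine Subset.antisymm hcovU ?_
      rintro y (hy | hy)
      all_goals
        obtain ⟨V, -, hVC, hyV⟩ := hUmem hy
        exact disjoint_left.1 (diverge_iff_disjoint_trace.1 hVC) hyV
    · rw [singleton_subset_iff]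
      have hxB := h.mem_trace hBu
      refine (hcovU x (disjoint_left.1 (diverge_iff_disjoint_trace.1 hBC) hxB)).resolve_right ?_
      intro hx
      obtain ⟨V₂, h₂, -, hx₂⟩ := hUmem hx
      exact hdisj hB h₂ hxB hx₂
    · intro y hy
      refine (hcovU y (disjoint_left.1 (diverge_iff_disjoint_trace.1 hAC) hy)).resolve_left ?_
      intro hy'
      obtain ⟨V₁, h₁, -, hy₁⟩ := hUmem hy'
      exact hdisj h₁ hV₀ hy₁ (higsonTrace_mono hAV₀ hy)

end Corona

-- Invariance under isometric embeddings.

section Coarse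

variable {X Y : Type*} [MetricSpace X] [MetricSpace Y]

theorem Isometry.isBounded_image_iff_isBounded {i : Y → X} (hi : Isometry i) {B : Set Y} :
    IsBounded (i '' B) ↔ IsBounded B :=
  ⟨fun h => (hi.antilipschitz.isBounded_preimage h).subset (subset_preimage_image i B),
    fun h => hi.lipschitz.isBounded_image h⟩

theorem Isometry.diverge_image_iff {i : Y → X} (hi : Isometry i) {A B : Set Y} :
    Diverge (i '' A) (i '' B) ↔ Diverge A B := by
  refine forall_congr' fun r => ?_
  rw [← hi.isBounded_image_iff_isBounded (B := {a ∈ A | ∃ b ∈ B, dist a b ≤ r})]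
  refine iff_of_eq (congrArg _ ?_)
  ext x
  constructor
  · rintro ⟨⟨a, ha, rfl⟩, _, ⟨b, hb, rfl⟩, hr⟩
    exact ⟨a, ⟨ha, b, hb, by rwa [hi.dist_eq] at hr⟩, rfl⟩
  · rintro ⟨a, ⟨ha, b, hb, hr⟩, rfl⟩
    exact ⟨⟨a, ha, rfl⟩, i b, ⟨b, hb, rfl⟩, by rwa [hi.dist_eq]⟩

theorem Isometry.map_le_cobounded_iff {i : Y → X} (hi : Isometry i) {u : Ultrafilter Y} :
    (u.map i : Filter X) ≤ cobounded X ↔ (u : Filter Y) ≤ cobounded Y := by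
  constructor
  · intro h B hB
    have h1 := (hi.isBounded_image_iff_isBounded).2 (isBounded_compl_iff.2 (isCobounded_def.2 hB))
    have h2 : i ⁻¹' (i '' Bᶜ)ᶜ ∈ u := h (isBounded_def.1 h1)
    rwa [preimage_compl, preimage_image_eq _ hi.injective, compl_compl] at h2
  · intro h B hB
    have h1 := hi.antilipschitz.isBounded_preimage (isBounded_compl_iff.2 (isCobounded_def.2 hB))
    have h2 := h (isBounded_def.1 h1)
    rwa [← preimage_compl, compl_compl] at h2

theorem Isometry.image_mem_map_iff {i : Y → X} (hi : Isometry i) {u : Ultrafilter Y} {A : Set Y} :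
    i '' A ∈ u.map i ↔ A ∈ u := by
  rw [Ultrafilter.mem_map, preimage_image_eq _ hi.injective]

theorem Isometry.awayFrom_map_iff {i : Y → X} (hi : Isometry i) {u : Ultrafilter Y} {A : Set Y} :
    AwayFrom (u.map i) (i '' A) ↔ AwayFrom u A := by
  constructor
  · rintro ⟨U, hU, h⟩
    exact ⟨i ⁻¹' U, hU, hi.diverge_image_iff.1 (h.mono (image_preimage_subset _ _) Subset.rfl)⟩
  · rintro ⟨U, hU, h⟩
    exact ⟨i '' U, hi.image_mem_map_iff.2 hU, hi.diverge_image_iff.2 h⟩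

theorem Isometry.coarseSeparator_map_iff {i : Y → X} (hi : Isometry i) {u : Ultrafilter Y}
    {S A C : Set Y} : CoarseSeparator (i '' S) (u.map i) (i '' A) (i '' C) ↔
      CoarseSeparator S u A C := by
  constructor
  · rintro ⟨𝒱₁, 𝒱₂, h12, hcov, ⟨B, hBu, hB, hBC⟩, ⟨V₀, hV₀, hAV₀⟩, hAC⟩
    refine ⟨preimage i '' 𝒱₁, preimage i '' 𝒱₂, ?_, fun D hD hDC => ?_,
      ⟨i ⁻¹' B, hBu, ⟨B, hB, rfl⟩, hi.diverge_image_iff.1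
        (hBC.mono (image_preimage_subset _ _) Subset.rfl)⟩,
      ⟨i ⁻¹' V₀, ⟨V₀, hV₀, rfl⟩, image_subset_iff.1 hAV₀⟩, hi.diverge_image_iff.1 hAC⟩
    · rintro _ ⟨V₁, h₁, rfl⟩ _ ⟨V₂, h₂, rfl⟩
      exact hi.diverge_image_iff.1 ((h12 V₁ h₁ V₂ h₂).mono (image_preimage_subset _ _)
        (image_preimage_subset _ _))
    · obtain ⟨V₁, h₁, V₂, h₂, hV⟩ := hcov (i '' D) (image_mono hD) (hi.diverge_image_iff.2 hDC)
      refine ⟨i ⁻¹' V₁, ⟨V₁, h₁, rfl⟩, i ⁻¹' V₂, ⟨V₂, h₂, rfl⟩, ?_⟩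
      rw [← preimage_union, ← hV, preimage_image_eq _ hi.injective]
  · rintro ⟨𝒱₁, 𝒱₂, h12, hcov, ⟨B, hBu, hB, hBC⟩, ⟨V₀, hV₀, hAV₀⟩, hAC⟩
    refine ⟨image i '' 𝒱₁, image i '' 𝒱₂, ?_, fun D hD hDC => ?_,
      ⟨i '' B, hi.image_mem_map_iff.2 hBu, ⟨B, hB, rfl⟩, hi.diverge_image_iff.2 hBC⟩,
      ⟨i '' V₀, ⟨V₀, hV₀, rfl⟩, image_mono hAV₀⟩, hi.diverge_image_iff.2 hAC⟩
    · rintro _ ⟨V₁, h₁, rfl⟩ _ ⟨V₂, h₂, rfl⟩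
      exact hi.diverge_image_iff.2 (h12 V₁ h₁ V₂ h₂)
    · obtain ⟨D, hDS, rfl⟩ := subset_image_iff.1 hD
      obtain ⟨V₁, h₁, V₂, h₂, rfl⟩ := hcov D hDS (hi.diverge_image_iff.1 hDC)
      exact ⟨i '' V₁, ⟨V₁, h₁, rfl⟩, i '' V₂, ⟨V₂, h₂, rfl⟩, image_union _ _ _⟩

theorem Isometry.coarseDimLT_image_iff {i : Y → X} (hi : Isometry i) {n : ℕ} :
    ∀ {S : Set Y}, CoarseDimLT n (i '' S) ↔ CoarseDimLT n S := by
  induction n with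
  | zero => exact hi.isBounded_image_iff_isBounded
  | succ n ih =>
    intro S
    constructor
    · intro h u hu hS A hA huA
      obtain ⟨C, hC, hsep, hdim⟩ := h (u.map i) (hi.map_le_cobounded_iff.2 hu)
        (hi.image_mem_map_iff.2 hS) (i '' A) (image_mono hA) (hi.awayFrom_map_iff.2 huA)
      obtain ⟨C, hCS, rfl⟩ := subset_image_iff.1 hC
      exact ⟨C, hCS, hi.coarseSeparator_map_iff.1 hsep, ih.1 hdim⟩
    · intro h w hw hSw A hA hwA
      obtain ⟨A, hAS, rfl⟩ := subset_image_iff.1 hA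
      obtain ⟨u, rfl⟩ : ∃ u : Ultrafilter Y, u.map i = w :=
        ⟨w.comap hi.injective (Filter.mem_of_superset hSw (image_subset_range _ _)),
          Ultrafilter.coe_injective (Filter.map_comap_of_mem
            (Filter.mem_of_superset hSw (image_subset_range _ _)))⟩
      obtain ⟨C, hCS, hsep, hdim⟩ := h u (hi.map_le_cobounded_iff.1 hw)
        (hi.image_mem_map_iff.1 hSw) A hAS (hi.awayFrom_map_iff.1 hwA)
      exact ⟨i '' C, image_mono hCS, hi.coarseSeparator_map_iff.2 hsep, ih.2 hdim⟩

theorem coarseDimLT_univ_coe {n : ℕ} {C : Set X} :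
    CoarseDimLT n (univ : Set C) ↔ CoarseDimLT n C := by
  rw [← isometry_subtype_coe.coarseDimLT_image_iff, image_univ, Subtype.range_coe]

end Coarse

-- Comparison of dimensions and conclusion.

section Dimension

/-- The asymptotic small inductive dimension agrees with the coarse dimension. -/
theorem asindLE_iff_coarseDimLT : ∀ (n : ℕ) (X : Type u) [MetricSpace X] [ProperSpace X],
    AsindLE n X ↔ CoarseDimLT (n + 1) (univ : Set X) := by
  have key : ∀ (n : ℕ) (X : Type u) [MetricSpace X] [ProperSpace X] (P : Set X → Prop),
      (∀ C, IsClosed C → (P C ↔ CoarseDimLT n C)) →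
      ((∀ (x : higsonCorona X) (A : Set X), x ∉ higsonTrace A →
        ∃ C : Set X, IsClosed C ∧ IsAsymptoticSeparator x A C ∧ P C) ↔
      CoarseDimLT (n + 1) (univ : Set X)) := by
    intro n X _ _ P hP
    constructor
    · intro h u hu _ A _ huA
      obtain ⟨x, hx⟩ := exists_represented hu
      obtain ⟨C, hC, hsep, hPC⟩ := h x A (hx.awayFrom_iff.1 huA)
      exact ⟨C, subset_univ _, hx.isAsymptoticSeparator_iff.1 hsep, (hP C hC).1 hPC⟩
    · intro h x A hxA
      obtain ⟨u, hu⟩ := exists_represents x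
      obtain ⟨C, -, hsep, hdim⟩ := h u hu.1 Filter.univ_mem A (subset_univ _)
        (hu.awayFrom_iff.2 hxA)
      -- Coarse separators need not be closed; taking the closure preserves both separation and the
      -- dimension bound.
      exact ⟨closure C, isClosed_closure, hu.isAsymptoticSeparator_iff.2 hsep.closure,
        (hP _ isClosed_closure).2 hdim.closure⟩
  intro n
  induction n with
  | zero =>
    intro X _ _
    refine key 0 X (fun C => IsBoundedSpace C) fun C _ => ?_
    exact coarseDimLT_univ_coe (n := 0)
  | succ n ih =>
    intro X _ _
    refine key (n + 1) X (fun C => AsindLE n C) fun C hC => ?_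
    have : ProperSpace C := .of_isClosed hC
    exact (ih C).trans coarseDimLT_univ_coe

/-- The induction hypothesis gives each separator a finite bound of its own, and
`exists_coarseDimLT_univ` turns these into one bound for `X`. -/
theorem TrasindLE.exists_coarseDimLT {α : Ordinal.{u}} : ∀ {X : Type u} [MetricSpace X]
    [ProperSpace X], TrasindLE α X → ∃ n, CoarseDimLT n (univ : Set X) := by
  induction α using WellFoundedLT.induction with
  | _ α ih =>
    intro X _ _ h
    rw [TrasindLE] at h
    refine exists_coarseDimLT_univ fun u hu A huA => ?_
    obtain ⟨x, hx⟩ := exists_represented hu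
    obtain ⟨C, hC, hsep, hdim⟩ := h x A (hx.awayFrom_iff.1 huA)
    refine ⟨C, hx.isAsymptoticSeparator_iff.1 hsep, ?_⟩
    have : ProperSpace C := .of_isClosed hC
    obtain ⟨n, hn⟩ : ∃ n, CoarseDimLT n (univ : Set C) := by
      rcases hdim with hb | ⟨β, hβ, hCβ⟩
      · exact ⟨0, hb⟩
      · exact ih β hβ hCβ
    exact ⟨n, coarseDimLT_univ_coe.1 hn⟩

end Dimension

theorem theorem1 (X : Type u) [MetricSpace X] [ProperSpace X] (h : trasind X < ⊤) :
    asind X < ⊤ := by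
  obtain ⟨n, hn⟩ : ∃ n, CoarseDimLT n (univ : Set X) := by
    rw [trasind] at h
    rcases eq_empty_or_nonempty {d : WithTop (WithBot Ordinal.{u}) | (d = ⊥ ∧ IsBoundedSpace X) ∨
      ∃ α : Ordinal.{u}, d = ((α : WithBot Ordinal.{u}) : WithTop (WithBot Ordinal.{u})) ∧
        TrasindLE α X} with he | ⟨d, ⟨-, hb⟩ | ⟨α, -, hα⟩⟩
    · rw [he, WithTop.sInf_empty] at h
      exact absurd h (lt_irrefl _)
    · exact ⟨0, hb⟩
    · exact hα.exists_coarseDimLT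
  -- `AsindLE n` corresponds to `CoarseDimLT (n + 1)`; giving up one dimension covers the bounded
  -- case `n = 0` too.
  have h1 : AsindLE n X := (asindLE_iff_coarseDimLT n X).2 hn.succ
  have h2 : asind X ≤ ((n : ℕ∞) : WithBot ℕ∞) := by
    rw [asind]
    exact sInf_le (Or.inr ⟨n, rfl, h1⟩)
  exact h2.trans_lt (WithBot.coe_lt_coe.2 (WithTop.coe_lt_top n))
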